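/- **Proposition 2.6 (Oleinik's condition in the plastic limit).** For $\varepsilon>0$ and $u_{\rm in}^\varepsilon\in H^2(\mathbb R)$ let $u^\varepsilon:[0,\infty)\times\mathbb R\to\mathbb R$ be a solution of the Cauchy problem for the viscoplastic Burgers equation $$\partial_t u^\varepsilon+\partial_x\tfrac{(u^\varepsilon)^2}{2}-\partial_x\Big(\frac{\partial_xu^\varepsilon}{\sqrt{|\partial_xu^\varepsilon|^2+\varepsilon^2}}\Big)-\varepsilon\,\partial_{xx}u^\varepsilon=0\ \text{ in }(0,\infty)\times\mathbb R,\qquad u^\varepsilon(0,\cdot)=u^\varepsilon_{\rm in},\qquad \lim_{|x|\to\infty}u^\varepsilon(t,x)=0\ \text{ for all } t\ge 0,$$ that is, for every $T>0$, $u^\varepsilon\in L^\infty(0,T;H^2(\mathbb R))$ and $\partial_tu^\varepsilon\in L^\infty(0,T;L^2(\mathbb R))\cap L^2(0,T;H^1(\mathbb R))$, $u^\varepsilon$ denotes the continuous representative, and $$\int_0^\infty\!\!\int_{\mathbb R}\Big(u^\varepsilon\partial_t\phi+\Big(\tfrac{(u^\varepsilon)^2}{2}-\varepsilon\partial_xu^\varepsilon-\tfrac{\partial_xu^\varepsilon}{\sqrt{|\partial_xu^\varepsilon|^2+\varepsilon^2}}\Big)\partial_x\phi\Big)\,dx\,dt+\int_{\mathbb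 R}u^\varepsilon_{\rm in}\,\phi(0)\,dx=0\quad\text{for all }\phi\in C^1_c([0,\infty)\times\mathbb R).$$ Let $\varepsilon_k>0$ with $\varepsilon_k\to0$, let $C>0$ be such that $\|\partial_xu_{\rm in}^{\varepsilon_k}\|_{L^1(\mathbb R)}\le C$ for all $k$ (so that $C$ is a uniform bound for $\|\partial_xu^{\varepsilon_k}\|_{L^\infty(0,\infty;L^1(\mathbb R))}$), and let $u\in C([0,\infty);L^1(\mathbb R))$ be a limit of these solutions, i.e. $u^{\varepsilon_k}\to u$ in $L^2((0,T)\times(-r,r))$ for all $T,r>0$. Then: 1. $u$ satisfies Oleinik's entropy condition $\mathrm D_xu(t)\le\frac1t$ in the sense of distributions for all $t>0$: $$-\int_{\mathbb R}u(t)\,\partial_x\phi\,dx\le\int_{\mathbb R}\frac{\phi}{t}\,dx\qquad\text{for all }\phi\in C_c^\infty(\mathbb R)\text{ with }\phi\ge0\text{ and all }t>0.$$ 2. For all $t>0$, a.e. $x\in\mathbb R$ and a.e. $h>0$, $$u(t,x+h)-u(t,x-h)<\frac{2h}{t}+4Ch.$$ -/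

import Mathlib

open MeasureTheory Filter Topology Set
open scoped ContDiff ENNReal NNReal

namespace PlasticBurgers

/-- The Sobolev space `H²(ℝ)`, each element being given by its `C¹` representative:
`f` is `C¹`, `f` and `f'` are square integrable, and `f'` has a square integrable weak derivative. -/
def MemH2 (f : ℝ → ℝ) : Prop :=
  ContDiff ℝ 1 f ∧ MemLp f 2 volume ∧ MemLp (deriv f) 2 volume ∧
    ∃ g : ℝ → ℝ, MemLp g 2 volume ∧
      ∀ φ : ℝ → ℝ, ContDiff ℝ ∞ φ → HasCompactSupport φ →
        ∫ x, deriv f x * deriv φ x = -∫ x, g x * φ x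

/-- The strip `(0,T) × ℝ` of pairs (time, space). -/
def strip (T : ℝ) : Set (ℝ × ℝ) := Ioo 0 T ×ˢ univ

/-- `f` belongs to `L^∞(0,T; L²(ℝ))`. -/
def MemLinftyL2 (T : ℝ) (f : ℝ → ℝ → ℝ) : Prop :=
  AEStronglyMeasurable (Function.uncurry f) (volume.restrict (strip T)) ∧
    ∃ M : ℝ≥0, ∀ᵐ t ∂(volume.restrict (Ioo 0 T)), eLpNorm (f t) 2 volume ≤ M

/-- `f` belongs to `L²(0,T; L²(ℝ)) = L²((0,T) × ℝ)`. -/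
def MemL2L2 (T : ℝ) (f : ℝ → ℝ → ℝ) : Prop :=
  MemLp (Function.uncurry f) 2 (volume.restrict (strip T))

/-- `g` is the weak partial derivative of `f` on `(0,∞) × ℝ` in the direction `e`;
`e = (1,0)` is the time derivative and `e = (0,1)` the space derivative. -/
def IsWeakPartial (e : ℝ × ℝ) (f g : ℝ → ℝ → ℝ) : Prop :=
  ∀ φ : ℝ × ℝ → ℝ, ContDiff ℝ ∞ φ → HasCompactSupport φ → tsupport φ ⊆ Ioi 0 ×ˢ univ →
    ∫ p in Ioi (0 : ℝ) ×ˢ (univ : Set ℝ), f p.1 p.2 * fderiv ℝ φ p e =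
      -∫ p in Ioi (0 : ℝ) ×ˢ (univ : Set ℝ), g p.1 p.2 * φ p

/-- The global solution `u : [0,∞) × ℝ → ℝ` (values at negative times are irrelevant) of the
viscoplastic Burgers equation
`∂ₜu + ∂ₓ(u²/2) - ∂ₓ(∂ₓu / √((∂ₓu)² + ε²)) - ε ∂ₓₓu = 0`
with initial datum `uin` and zero far field: for all `T > 0` it lies in `L^∞(0,T; H²(ℝ))` with
`∂ₜu ∈ L^∞(0,T; L²(ℝ)) ∩ L²(0,T; H¹(ℝ))`, and it solves the equation in the integral sense.
As usual `u` stands for the continuous representative of its class. -/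
structure IsViscoplasticSolution (ε : ℝ) (uin : ℝ → ℝ) (u : ℝ → ℝ → ℝ) : Prop where
  continuousOn : ContinuousOn (Function.uncurry u) (Ici 0 ×ˢ univ)
  initial : ∀ x, u 0 x = uin x
  farField : ∀ t, 0 ≤ t → Tendsto (u t) (cocompact ℝ) (𝓝 0)
  weak : ∃ ux uxx ut utx : ℝ → ℝ → ℝ,
    IsWeakPartial (0, 1) u ux ∧ IsWeakPartial (0, 1) ux uxx ∧
    IsWeakPartial (1, 0) u ut ∧ IsWeakPartial (0, 1) ut utx ∧
    (∀ T : ℝ, 0 < T →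
      MemLinftyL2 T u ∧ MemLinftyL2 T ux ∧ MemLinftyL2 T uxx ∧
      MemLinftyL2 T ut ∧ MemL2L2 T ut ∧ MemL2L2 T utx) ∧
    -- test functions in `C¹_c([0,∞) × ℝ)` are the restrictions of those in `C¹_c(ℝ × ℝ)`
    ∀ φ : ℝ × ℝ → ℝ, ContDiff ℝ 1 φ → HasCompactSupport φ →
      (∫ p in Ioi (0 : ℝ) ×ˢ (univ : Set ℝ),
        (u p.1 p.2 * fderiv ℝ φ p (1, 0) +
          ((u p.1 p.2) ^ 2 / 2 - ε * ux p.1 p.2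
            - ux p.1 p.2 / Real.sqrt ((ux p.1 p.2) ^ 2 + ε ^ 2)) * fderiv ℝ φ p (0, 1)))
      + ∫ x, uin x * φ (0, x) = 0

/-- `u` belongs to `C([0,∞); L¹(ℝ))`; here `u t` represents the value at time `t`. -/
def MemCL1 (u : ℝ → ℝ → ℝ) : Prop :=
  (∀ t, 0 ≤ t → Integrable (u t) volume) ∧
    ∀ t, 0 ≤ t → Tendsto (fun s => eLpNorm (u s - u t) 1 volume) (𝓝[Ici 0] t) (𝓝 0)

/-- `v k → u` in `L²((0,T) × (-r,r))` for all `T, r > 0`. -/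
def TendstoL2loc (v : ℕ → ℝ → ℝ → ℝ) (u : ℝ → ℝ → ℝ) : Prop :=
  AEStronglyMeasurable (Function.uncurry u) (volume.restrict (Ioi 0 ×ˢ univ)) ∧
    ∀ T r : ℝ, 0 < T → 0 < r →
      Tendsto (fun k => eLpNorm (fun p : ℝ × ℝ => v k p.1 p.2 - u p.1 p.2) 2
        (volume.restrict (Ioo 0 T ×ˢ Ioo (-r) r))) atTop (𝓝 0)

end PlasticBurgers

namespace PlasticBurgers

/-! The whole theorem rests on a bound uniform in the viscosity: each regularized solution satisfies
`∂ₓu ≤ 1/t`. Formally `V = ∂ₓu` solves `∂ₜV + V² + u ∂ₓV = ∂ₓₓ A(V)`, where `A` is the increasing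
function `flux ε`, and `1/t` is a solution constant in space. The comparison is carried out by
testing with `N²`, where `N = (V - 1/t)₊`. Diffusion and quadratic transport both contribute with a
favourable sign (`integral_posPart_sq_mul_le_zero`), so that `∫ N² (∂ₜV + 1/t²) dx ≤ 0` for almost
every time.

The factor `N² (∂ₜV + 1/t²)` is the time derivative of `N³/3`. Since `V` is bounded by some `K` on
`(0,T) × ℝ`, by the `H²` bound, `N` vanishes at any time `a` with `K ≤ 1/a`; integrating from such
an `a` forces `N = 0` (`ae_le_one_div`). Integration in space and continuity in time give `u(t,y) -
u(t,x) ≤ (y-x)/t` for all `x ≤ y` and all `t > 0` (`IsViscoplasticSolution.sub_le_div`).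

The only derivatives available are weak ones in two variables, so the computation is made on slices:
on almost every line, a weak partial derivative makes the function a primitive
(`ae_isPrimitiveOn_slice`). The slice in time uses that `∂ₓ∂ₜu` is also the weak time derivative of
`∂ₓu`.

The one-sided Lipschitz bound survives almost everywhere convergence along subsequences, hence holds
for the limit at almost every time; continuity in `L¹` extends it to every `t > 0`
(`exists_conull_slice`). Both conclusions follow: difference quotients moved onto the test function
give the first, and points at distance `2h` give the second, where the positive term `4Ch` makes the
inequality strict. -/

/-! ### Primitives, integration by parts and the du Bois-Reymond lemma -/

/-- `f` agrees almost everywhere on `Y` with a primitive of `g`; `y₀` is the base point. -/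
def IsPrimitiveOn (Y : Set ℝ) (y₀ : ℝ) (f g : ℝ → ℝ) : Prop :=
  LocallyIntegrable g volume ∧ ∃ c : ℝ, ∀ᵐ y, y ∈ Y → f y = c + ∫ z in y₀..y, g z

theorem _root_.MeasureTheory.LocallyIntegrable.intervalIntegrable_uIoc {g : ℝ → ℝ}
    (hg : LocallyIntegrable g volume) (a b : ℝ) : IntervalIntegrable g volume a b :=
  intervalIntegrable_iff.mpr
    ((hg.integrableOn_isCompact isCompact_uIcc).mono_set uIoc_subset_uIcc)

theorem absolutelyContinuousOnInterval_primitive {g : ℝ → ℝ} (hg : LocallyIntegrable g volume)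
    (c y₀ a b : ℝ) : AbsolutelyContinuousOnInterval (fun y => c + ∫ z in y₀..y, g z) a b := by
  have h1 : AbsolutelyContinuousOnInterval (fun y => ∫ z in y₀..y, g z) a b := by
    have h := (hg.intervalIntegrable_uIoc (min a (min b y₀))
      (max a (max b y₀))).absolutelyContinuousOnInterval_intervalIntegral (c := y₀)
      (by rw [uIcc_of_le ((min_le_left _ _).trans (le_max_left _ _))]; simp)
    refine h.mono ?_
    rw [uIcc_of_le (a := min a (min b y₀)) ((min_le_left _ _).trans (le_max_left _ _)), uIcc]
    exact Icc_subset_Icc (min_le_min le_rfl (min_le_left _ _)) (max_le_max le_rfl (le_max_left _ _))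
  have h2 : AbsolutelyContinuousOnInterval (fun _ : ℝ => c) a b :=
    (contDiff_const (n := 1)).contDiffOn.absolutelyContinuousOnInterval
  exact h2.fun_add h1

theorem continuous_const_add_primitive {g : ℝ → ℝ} (hg : LocallyIntegrable g volume) (c y₀ : ℝ) :
    Continuous (fun y => c + ∫ z in y₀..y, g z) :=
  continuous_const.add (intervalIntegral.continuous_primitive hg.intervalIntegrable_uIoc y₀)

theorem ae_hasDerivAt_primitive {g : ℝ → ℝ} (hg : LocallyIntegrable g volume) (c y₀ : ℝ) :
    ∀ᵐ y, HasDerivAt (fun y => c + ∫ z in y₀..y, g z) (g y) y := by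
  filter_upwards [_root_.LocallyIntegrable.ae_hasDerivAt_integral hg] with y hy
  simpa using (hy y₀).const_add c

/-- Integration by parts for a primitive of a locally integrable function against an absolutely
continuous function. -/
theorem integral_mul_primitive {g p p' : ℝ → ℝ} (hg : LocallyIntegrable g volume) (c y₀ : ℝ)
    {a b : ℝ} (hp : AbsolutelyContinuousOnInterval p a b)
    (hp' : ∀ᵐ y, y ∈ uIcc a b → HasDerivAt p (p' y) y) :
    ∫ y in a..b, p y * g y = p b * (c + ∫ z in y₀..b, g z) - p a * (c + ∫ z in y₀..a, g z)
      - ∫ y in a..b, p' y * (c + ∫ z in y₀..y, g z) := by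
  have h := hp.integral_mul_deriv_eq_deriv_mul (absolutelyContinuousOnInterval_primitive hg c y₀ a b)
  have h1 : ∫ y in a..b, p y * g y
      = ∫ y in a..b, p y * deriv (fun y => c + ∫ z in y₀..y, g z) y := by
    apply intervalIntegral.integral_congr_ae
    filter_upwards [ae_hasDerivAt_primitive hg c y₀] with y hy _
    rw [hy.deriv]
  have h2 : ∫ y in a..b, p' y * (c + ∫ z in y₀..y, g z)
      = ∫ y in a..b, deriv p y * (c + ∫ z in y₀..y, g z) := by
    apply intervalIntegral.integral_congr_ae
    filter_upwards [hp'] with y hy hm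
    rw [(hy (uIoc_subset_uIcc hm)).deriv]
  rw [h1, h2, h]

/-- Needed for the positive part in time, where `V` is merely absolutely continuous. -/
theorem _root_.LipschitzWith.comp_absolutelyContinuousOnInterval {h f : ℝ → ℝ} {K : ℝ≥0}
    (hh : LipschitzWith K h) {a b : ℝ} (hf : AbsolutelyContinuousOnInterval f a b) :
    AbsolutelyContinuousOnInterval (fun x => h (f x)) a b := by
  unfold AbsolutelyContinuousOnInterval at hf ⊢
  have h2 := hf.const_mul (K : ℝ)
  rw [mul_zero] at h2
  refine squeeze_zero (fun t => Finset.sum_nonneg (fun i _ => dist_nonneg)) (fun t => ?_) h2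
  rw [Finset.mul_sum]
  exact Finset.sum_le_sum (fun i _ => hh.dist_le_mul _ _)

/-- The one-dimensional du Bois-Reymond lemma: a function with an integrable weak derivative is
a primitive of it. -/
theorem isPrimitiveOn_of_weak {Y : Set ℝ} (hY : IsOpen Y) (hc : Y.OrdConnected) {y₀ : ℝ}
    (hy₀ : y₀ ∈ Y) {f g : ℝ → ℝ} (hf : LocallyIntegrable f volume)
    (hg : LocallyIntegrable g volume)
    (h : ∀ φ : ℝ → ℝ, ContDiff ℝ ∞ φ → HasCompactSupport φ → tsupport φ ⊆ Y →
      ∫ y, f y * deriv φ y = -∫ y, g y * φ y) :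
    IsPrimitiveOn Y y₀ f g := by
  refine ⟨hg, ?_⟩
  obtain ⟨η, hη1, hη2, hη3, hη4, hη5⟩ :=
    exists_contDiff_tsupport_subset (n := ⊤) (hY.mem_nhds hy₀)
  have hηm : 0 < ∫ y, η y :=
    hη3.continuous.integral_pos_of_hasCompactSupport_nonneg_nonzero hη2
      (fun y => (hη4 (mem_range_self y)).1) (x := y₀) (by rw [hη5]; norm_num)
  set m := ∫ y, η y with hm
  have hG : Continuous (fun y => ∫ z in y₀..y, g z) :=
    intervalIntegral.continuous_primitive hg.intervalIntegrable_uIoc y₀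
  set G : ℝ → ℝ := fun y => ∫ z in y₀..y, g z with hGdef
  have hfG : LocallyIntegrable (fun y => f y - G y) volume := hf.sub hG.locallyIntegrable
  -- The constant is the `η`-weighted mean of `f - G`, the only value compatible with testing
  -- against `η`.
  set c := (∫ y, η y * (f y - G y)) / m with hcdef
  have hfGc : LocallyIntegrable (fun y => f y - G y - c) volume :=
    hfG.sub continuous_const.locallyIntegrable
  refine ⟨c, ?_⟩
  have key : ∀ᵐ y, y ∈ Y → f y - G y - c = 0 := by
    refine hY.ae_eq_zero_of_integral_contDiff_smul_eq_zero (hfGc.locallyIntegrableOn Y) ?_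
    intro φ hφ hφc hφY
    set Φ := ∫ y, φ y with hΦ
    -- Subtracting this multiple of `η` makes the mean zero, so that `θ` is the derivative of a
    -- compactly supported test function.
    set θ : ℝ → ℝ := fun y => φ y - Φ / m * η y with hθ
    have hθs : ContDiff ℝ ∞ θ := hφ.sub (contDiff_const.mul hη3)
    have hφi : Integrable φ volume := hφ.continuous.integrable_of_hasCompactSupport hφc
    have hηi : Integrable η volume := hη3.continuous.integrable_of_hasCompactSupport hη2
    have hθ0 : ∫ y, θ y = 0 := by
      rw [hθ, integral_sub hφi (hηi.const_mul _), integral_const_mul, ← hm, ← hΦ]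
      field_simp
      simp
    set K := tsupport φ ∪ tsupport η with hK
    have hKc : IsCompact K := hφc.isCompact.union hη2.isCompact
    have hKn : K.Nonempty := ⟨y₀, Or.inr (subset_tsupport _ (by simp [hη5]))⟩
    have hKY : K ⊆ Y := union_subset hφY hη1
    set A := sInf K
    set B := sSup K
    have hAY : A ∈ Y := hKY (hKc.sInf_mem hKn)
    have hBY : B ∈ Y := hKY (hKc.sSup_mem hKn)
    have hKAB : K ⊆ Icc A B := fun y hy =>
      ⟨csInf_le hKc.bddBelow hy, le_csSup hKc.bddAbove hy⟩
    have hθz : ∀ y, y ∉ Icc A B → θ y = 0 := by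
      intro y hy
      have hy' : y ∉ K := fun hh => hy (hKAB hh)
      have h1 : φ y = 0 := image_eq_zero_of_notMem_tsupport (fun hh => hy' (Or.inl hh))
      have h2 : η y = 0 := image_eq_zero_of_notMem_tsupport (fun hh => hy' (Or.inr hh))
      simp [hθ, h1, h2]
    have hAB : A ≤ B := by
      obtain ⟨y, hy⟩ := hKn
      exact (hKAB hy).1.trans (hKAB hy).2
    -- a primitive starting to the left of the support
    set ψ : ℝ → ℝ := fun y => ∫ z in (A - 1)..y, θ z with hψ
    have hψd : ∀ y, HasDerivAt ψ (θ y) y := fun y =>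
      intervalIntegral.integral_hasDerivAt_right (hθs.continuous.intervalIntegrable _ _)
        (hθs.continuous.stronglyMeasurableAtFilter _ _) hθs.continuous.continuousAt
    have hψs : ContDiff ℝ ∞ ψ := by
      rw [contDiff_infty_iff_deriv]
      refine ⟨fun y => (hψd y).differentiableAt, ?_⟩
      have : deriv ψ = θ := funext fun y => (hψd y).deriv
      rwa [this]
    have hψz : ∀ y, y ∉ Icc A B → ψ y = 0 := by
      intro y hy
      rw [mem_Icc, not_and_or, not_le, not_le] at hy
      rcases hy with hy | hy
      · have : ∫ z in (A - 1)..y, θ z = ∫ z in (A - 1)..y, (0 : ℝ) := by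
          apply intervalIntegral.integral_congr
          intro z hz
          apply hθz
          intro hz2
          have : max (A - 1) y < A := max_lt (by linarith) hy
          exact absurd (hz.2.trans_lt this) (not_lt.mpr hz2.1)
        rw [hψ]; simp only; rw [this]; simp
      · rw [hψ]; simp only
        rw [intervalIntegral.integral_eq_integral_of_support_subset, hθ0]
        intro z hz
        have hz' : z ∈ Icc A B := by
          by_contra hcon
          exact hz (hθz z hcon)
        exact ⟨by linarith [hz'.1], by linarith [hz'.2]⟩
    have hψt : tsupport ψ ⊆ Icc A B :=
      closure_minimal (fun y hy => by by_contra hcon; exact hy (hψz y hcon)) isClosed_Icc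
    have hψc : HasCompactSupport ψ := isCompact_Icc.of_isClosed_subset (isClosed_tsupport _) hψt
    -- The support of `ψ` may fill the gaps between the supports of `φ` and `η`; order-connectedness
    -- keeps `[A, B]` inside `Y`.
    have hw := h ψ hψs hψc (hψt.trans (hc.out hAY hBY))
    have hdψ : deriv ψ = θ := funext fun y => (hψd y).deriv
    rw [hdψ] at hw
    have hI : ∫ y, g y * ψ y = -∫ y, θ y * G y := by
      have e1 : ∫ y, g y * ψ y = ∫ y in (A - 1)..(B + 1), ψ y * g y := by
        rw [intervalIntegral.integral_eq_integral_of_support_subset]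
        · simp_rw [mul_comm]
        · intro z hz
          have hz' : z ∈ Icc A B := by
            by_contra hcon
            exact hz (by simp [hψz z hcon])
          exact ⟨by linarith [hz'.1], by linarith [hz'.2]⟩
      have e2 : ∫ y, θ y * G y = ∫ y in (A - 1)..(B + 1), θ y * G y := by
        rw [intervalIntegral.integral_eq_integral_of_support_subset]
        intro z hz
        have hz' : z ∈ Icc A B := by
          by_contra hcon
          exact hz (by simp [hθz z hcon])
        exact ⟨by linarith [hz'.1], by linarith [hz'.2]⟩
      have hψac : AbsolutelyContinuousOnInterval ψ (A - 1) (B + 1) :=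
        (hψs.of_le (by simp)).contDiffOn.absolutelyContinuousOnInterval
      have e3 := integral_mul_primitive hg 0 y₀ hψac (Eventually.of_forall fun y _ => hψd y)
      rw [e1, e3, e2, hψz (A - 1) (by simp), hψz (B + 1) (by simp)]
      simp [hGdef]
    have hφfG := hfG.integrable_smul_left_of_hasCompactSupport hφ.continuous hφc
    have hηfG := hfG.integrable_smul_left_of_hasCompactSupport hη3.continuous hη2
    have hθc : HasCompactSupport θ :=
      isCompact_Icc.of_isClosed_subset (isClosed_tsupport _)
        (closure_minimal (fun y hy => by by_contra hcon; exact hy (hθz y hcon)) isClosed_Icc)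
    have hθf := hf.integrable_smul_left_of_hasCompactSupport hθs.continuous hθc
    have hθG := hG.locallyIntegrable.integrable_smul_left_of_hasCompactSupport
      hθs.continuous hθc (μ := volume)
    simp only [smul_eq_mul] at hφfG hηfG hθf hθG ⊢
    have hz : ∫ y, θ y * (f y - G y) = 0 := by
      have : ∀ y, θ y * (f y - G y) = θ y * f y - θ y * G y := fun y => by ring
      simp_rw [this]
      rw [integral_sub hθf hθG]
      have : ∫ y, θ y * f y = ∫ y, f y * θ y := by simp_rw [mul_comm]
      rw [this, hw, hI]; ring
    have hz2 : ∫ y, θ y * (f y - G y)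
        = (∫ y, φ y * (f y - G y)) - Φ / m * ∫ y, η y * (f y - G y) := by
      rw [← integral_const_mul, ← integral_sub hφfG (hηfG.const_mul _)]
      congr 1; ext y; simp only [hθ]; ring
    have hz3 : ∫ y, φ y * (f y - G y - c) = (∫ y, φ y * (f y - G y)) - Φ * c := by
      rw [hΦ, ← integral_mul_const, ← integral_sub hφfG (hφi.mul_const _)]
      congr 1; ext y; ring
    rw [hz3, hcdef]
    rw [hz] at hz2
    have : Φ * ((∫ y, η y * (f y - G y)) / m) = Φ / m * ∫ y, η y * (f y - G y) := by ring
    rw [this]; linarith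
  filter_upwards [key] with y hy hyY
  have := hy hyY
  simp only [hGdef] at this
  linarith

/-! ### The flux and elementary differentiation -/

/-- The viscoplastic flux `p ↦ p / √(p² + ε²) + ε p`. -/
noncomputable def flux (ε p : ℝ) : ℝ := p / √(p ^ 2 + ε ^ 2) + ε * p

/-- The derivative of the viscoplastic flux. -/
noncomputable def fluxDeriv (ε p : ℝ) : ℝ := ε ^ 2 / (√(p ^ 2 + ε ^ 2)) ^ 3 + ε

theorem continuous_flux {ε : ℝ} (hε : 0 < ε) : Continuous (flux ε) := by
  unfold flux
  have : ∀ p : ℝ, √(p ^ 2 + ε ^ 2) ≠ 0 := fun p => by positivity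
  fun_prop (disch := exact this _)

theorem continuous_fluxDeriv {ε : ℝ} (hε : 0 < ε) : Continuous (fluxDeriv ε) := by
  unfold fluxDeriv
  have : ∀ p : ℝ, (√(p ^ 2 + ε ^ 2)) ^ 3 ≠ 0 := fun p => by positivity
  fun_prop (disch := exact this _)

theorem fluxDeriv_pos {ε : ℝ} (hε : 0 < ε) (p : ℝ) : 0 < fluxDeriv ε p := by
  unfold fluxDeriv; positivity

theorem hasStrictDerivAt_flux {ε : ℝ} (hε : 0 < ε) (p : ℝ) :
    HasStrictDerivAt (flux ε) (fluxDeriv ε p) p := by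
  have h0 : 0 < p ^ 2 + ε ^ 2 := by positivity
  have hs : 0 < √(p ^ 2 + ε ^ 2) := Real.sqrt_pos.mpr h0
  have hd : HasStrictDerivAt (fun p : ℝ => p ^ 2 + ε ^ 2) (2 * p) p := by
    simpa using ((hasStrictDerivAt_id p).pow 2).add_const (ε ^ 2)
  have h1 := ((hasStrictDerivAt_id p).div (hd.sqrt h0.ne') hs.ne').add
    ((hasStrictDerivAt_id p).const_mul ε)
  refine h1.congr_deriv ?_
  have hsq : √(p ^ 2 + ε ^ 2) ^ 2 = p ^ 2 + ε ^ 2 := Real.sq_sqrt h0.le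
  simp only [id, fluxDeriv]
  field_simp
  rw [hsq]; ring

/-- Near `x`, `V` is the local inverse of `A` composed with `A ∘ V`; continuity of `V` keeps its
values where the local inverse is valid. This transfers regularity from the flux to `∂ₓu`. -/
theorem _root_.HasStrictDerivAt.hasDerivAt_of_comp {A V : ℝ → ℝ} {a' d x : ℝ}
    (hA : HasStrictDerivAt A a' (V x)) (ha : a' ≠ 0) (hV : ContinuousAt V x)
    (hd : HasDerivAt (fun y => A (V y)) d x) : HasDerivAt V (a'⁻¹ * d) x := by
  have h1 := (hA.to_localInverse ha).hasDerivAt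
  have h2 : HasDerivAt (fun y => HasStrictDerivAt.localInverse A a' (V x) hA ha (A (V y)))
      (a'⁻¹ * d) x := HasDerivAt.comp (h₂ := HasStrictDerivAt.localInverse A a' (V x) hA ha) x h1 hd
  refine h2.congr_of_eventuallyEq ?_
  have h3 := HasStrictFDerivAt.eventually_left_inverse
    (f' := ContinuousLinearEquiv.unitsEquivAut ℝ (Units.mk0 a' ha)) hA
  exact (hV.eventually h3).mono fun y hy => hy.symm

theorem hasDerivAt_posPart_pow (n : ℕ) (s : ℝ) :
    HasDerivAt (fun s : ℝ => (max s 0) ^ (n + 2)) ((n + 2) * (max s 0) ^ (n + 1)) s := by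
  rcases lt_trichotomy s 0 with h | h | h
  · rw [max_eq_right h.le]
    have : HasDerivAt (fun _ : ℝ => (0 : ℝ)) ((n + 2) * 0 ^ (n + 1)) s := by
      simpa using hasDerivAt_const s (0 : ℝ)
    refine this.congr_of_eventuallyEq ?_
    filter_upwards [gt_mem_nhds h] with y hy
    rw [max_eq_right hy.le]; simp
  · subst h
    have : (fun s : ℝ => (max s 0) ^ (n + 2)) =O[𝓝 0] fun x => ‖x - 0‖ ^ (n + 2) := by
      refine Asymptotics.IsBigO.of_bound 1 (Eventually.of_forall fun x => ?_)
      rw [one_mul, norm_pow, norm_pow, norm_norm]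
      gcongr
      rw [sub_zero, Real.norm_eq_abs, Real.norm_eq_abs, abs_of_nonneg (le_max_right _ _)]
      exact max_le (le_abs_self x) (abs_nonneg x)
    have h2 := (this.hasFDerivAt (by omega)).hasDerivAt
    simpa using h2
  · rw [max_eq_left h.le]
    have : HasDerivAt (fun s : ℝ => s ^ (n + 2)) ((n + 2) * s ^ (n + 1)) s := by
      simpa using hasDerivAt_pow (n + 2) s
    refine this.congr_of_eventuallyEq ?_
    filter_upwards [lt_mem_nhds h] with y hy
    rw [max_eq_left hy.le]

/-! ### Energy inequality on one time slice -/

theorem tendsto_sq_zero_of_memLp_two {V W : ℝ → ℝ} (hV : MemLp V 2 volume)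
    (hW : MemLp W 2 volume) (hd : ∀ x, HasDerivAt V (W x) x) :
    Tendsto (fun x => V x ^ 2) atTop (𝓝 0) ∧ Tendsto (fun x => V x ^ 2) atBot (𝓝 0) := by
  have hd2 : ∀ x, HasDerivAt (fun x => V x ^ 2) (2 * (V x * W x)) x := fun x => by
    refine ((hd x).pow 2).congr_deriv ?_
    simp; ring
  have hi1 : Integrable (fun x => V x ^ 2) volume := hV.integrable_sq
  have hi2 : Integrable (fun x => 2 * (V x * W x)) volume := (hV.integrable_mul hW).const_mul 2
  exact ⟨tendsto_zero_of_hasDerivAt_of_integrableOn_Ioi (a := 0) (fun x _ => hd2 x)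
    hi2.integrableOn hi1.integrableOn,
    tendsto_zero_of_hasDerivAt_of_integrableOn_Iic (a := 0) (fun x _ => hd2 x)
    hi2.integrableOn hi1.integrableOn⟩

/-- Integrate `(V²)' = 2VW ≤ V² + W²` from `-∞`. This Sobolev bound supplies the constant `K` that
starts the comparison with `1/t`. -/
theorem sq_le_integral_of_hasDerivAt {V W : ℝ → ℝ} (hV : MemLp V 2 volume)
    (hW : MemLp W 2 volume) (hd : ∀ x, HasDerivAt V (W x) x) (x : ℝ) :
    V x ^ 2 ≤ (∫ y, V y ^ 2) + ∫ y, W y ^ 2 := by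
  have hd2 : ∀ x, HasDerivAt (fun x => V x ^ 2) (2 * (V x * W x)) x := fun x => by
    refine ((hd x).pow 2).congr_deriv ?_
    simp; ring
  have hi1 : Integrable (fun x => V x ^ 2) volume := hV.integrable_sq
  have hi3 : Integrable (fun x => W x ^ 2) volume := hW.integrable_sq
  have hi2 : Integrable (fun x => 2 * (V x * W x)) volume := (hV.integrable_mul hW).const_mul 2
  have h := integral_Iic_of_hasDerivAt_of_tendsto' (a := x) (fun y _ => hd2 y) hi2.integrableOn
    (tendsto_sq_zero_of_memLp_two hV hW hd).2
  rw [sub_zero] at h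
  rw [← h, ← integral_add hi1 hi3]
  calc ∫ y in Iic x, 2 * (V y * W y) ≤ ∫ y in Iic x, (V y ^ 2 + W y ^ 2) :=
        setIntegral_mono hi2.integrableOn (hi1.add hi3).integrableOn
          fun y => by simp only; nlinarith [sq_nonneg (V y - W y)]
    _ ≤ ∫ y, (V y ^ 2 + W y ^ 2) :=
        setIntegral_le_integral (hi1.add hi3) (Eventually.of_forall fun y => by
          simp only [Pi.zero_apply]; positivity)

/-- The energy inequality in classical form, on one time slice. -/
theorem integral_posPart_sq_mul_le_zero {u V W A' r : ℝ → ℝ} {l : ℝ} (hl : 0 < l)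
    (hu : ∀ x, HasDerivAt u (V x) x) (hV : ∀ x, HasDerivAt V (W x) x) (hW : Continuous W)
    (hA : Continuous A') (hA0 : ∀ x, 0 ≤ A' x)
    (htop : Tendsto (fun x => V x ^ 2) atTop (𝓝 0))
    (hbot : Tendsto (fun x => V x ^ 2) atBot (𝓝 0))
    (hr : LocallyIntegrable r volume) (c : ℝ)
    (heq : ∀ x, A' x * W x - u x * V x = c + ∫ y in (0 : ℝ)..x, r y) :
    ∫ x, (max (V x - l) 0) ^ 2 * (r x + l ^ 2) ≤ 0 := by
  have hVc : Continuous V := continuous_iff_continuousAt.mpr fun x => (hV x).continuousAt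
  have huc : Continuous u := continuous_iff_continuousAt.mpr fun x => (hu x).continuousAt
  -- Because `l > 0` and `V` decays, the truncation has bounded support and no boundary terms at
  -- infinity remain.
  obtain ⟨R, hR0, hR⟩ : ∃ R > 0, ∀ x, R ≤ |x| → max (V x - l) 0 = 0 := by
    have h1 := htop.eventually (gt_mem_nhds (show (0 : ℝ) < l ^ 2 by positivity))
    have h2 := hbot.eventually (gt_mem_nhds (show (0 : ℝ) < l ^ 2 by positivity))
    obtain ⟨a, ha⟩ := eventually_atTop.mp h1
    obtain ⟨b, hb⟩ := eventually_atBot.mp h2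
    refine ⟨max 1 (max a (-b)), by positivity, fun x hx => ?_⟩
    have hx2 : V x ^ 2 < l ^ 2 := by
      rcases le_total 0 x with h | h
      · rw [abs_of_nonneg h] at hx
        exact ha x (((le_max_left _ _).trans (le_max_right _ _)).trans hx)
      · rw [abs_of_nonpos h] at hx
        exact hb x (by linarith [((le_max_right a (-b)).trans (le_max_right 1 _)).trans hx])
    have := abs_lt_of_sq_lt_sq hx2 hl.le
    exact max_eq_right (by linarith [le_abs_self (V x)])
  set N : ℝ → ℝ := fun x => max (V x - l) 0 with hN
  have hNc : Continuous N := (hVc.sub continuous_const).max continuous_const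
  have hN2 : ∀ x, HasDerivAt (fun x => N x ^ 2) (2 * N x * W x) x := fun x => by
    have := (hasDerivAt_posPart_pow 0 (V x - l)).comp x ((hV x).sub_const l)
    refine this.congr_deriv ?_
    simp [hN]
  have hN3 : ∀ x, HasDerivAt (fun x => N x ^ 3) (3 * N x ^ 2 * W x) x := fun x => by
    have := (hasDerivAt_posPart_pow 1 (V x - l)).comp x ((hV x).sub_const l)
    refine this.congr_deriv ?_
    change (((1 : ℕ) : ℝ) + 2) * N x ^ (1 + 1) * W x = _
    push_cast; ring
  have hRR : (-R) ≤ R := by linarith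
  have hNR : N R = 0 := hR R (le_abs_self R)
  have hNR' : N (-R) = 0 := hR (-R) (by rw [abs_neg]; exact le_abs_self R)
  have e1 : ∫ x, N x ^ 2 * (r x + l ^ 2) = ∫ x in (-R)..R, N x ^ 2 * (r x + l ^ 2) := by
    rw [intervalIntegral.integral_eq_integral_of_support_subset]
    intro z hz
    by_contra hcon
    apply hz
    have : R ≤ |z| := by
      rw [mem_Ioc, not_and_or, not_lt, not_le] at hcon
      rcases hcon with h | h
      · rw [abs_of_nonpos (by linarith)]; linarith
      · exact h.le.trans (le_abs_self z)
    have h0 : N z = 0 := hR z this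
    simp [h0]
  have hNac : AbsolutelyContinuousOnInterval (fun x => N x ^ 2) (-R) R := by
    refine (ContDiff.contDiffOn ?_).absolutelyContinuousOnInterval
    rw [contDiff_one_iff_deriv]
    refine ⟨fun x => (hN2 x).differentiableAt, ?_⟩
    rw [show deriv (fun x => N x ^ 2) = fun x => 2 * N x * W x from funext fun x => (hN2 x).deriv]
    fun_prop
  have e2 := integral_mul_primitive hr c 0 hNac (Eventually.of_forall fun x _ => hN2 x)
  simp only [hNR, hNR'] at e2
  simp_rw [← heq] at e2
  have hNr : IntervalIntegrable (fun x => N x ^ 2 * r x) volume (-R) R :=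
    (hr.intervalIntegrable_uIoc _ _).continuousOn_mul (by fun_prop)
  -- The integrand is the derivative of `uVN² - uN³/3`, which vanishes at `±R`. It trades the
  -- transport term, containing `u` of unknown sign, for terms in `V` and `N` only.
  have e3 : ∫ x in (-R)..R, (V x ^ 2 * N x ^ 2 - V x * N x ^ 3 / 3 + 2 * u x * V x * N x * W x)
      = 0 := by
    have hd : ∀ x, HasDerivAt (fun x => u x * V x * N x ^ 2 - u x * N x ^ 3 / 3)
        (V x ^ 2 * N x ^ 2 - V x * N x ^ 3 / 3 + 2 * u x * V x * N x * W x) x := fun x => by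
      have := (((hu x).mul (hV x)).mul (hN2 x)).sub (((hu x).mul (hN3 x)).div_const 3)
      refine this.congr_deriv ?_
      simp only [Pi.mul_apply]
      have : N x * N x = (V x - l) * N x := by
        simp only [hN]
        rcases le_total (V x - l) 0 with h | h
        · simp [max_eq_right h]
        · simp [max_eq_left h]
      ring
    rw [intervalIntegral.integral_eq_sub_of_hasDerivAt (fun x _ => hd x)
      (by apply Continuous.intervalIntegrable; fun_prop)]
    simp [hNR, hNR']
  rw [e1]
  have e4 : ∫ x in (-R)..R, N x ^ 2 * (r x + l ^ 2)
      = (∫ x in (-R)..R, N x ^ 2 * r x) + ∫ x in (-R)..R, N x ^ 2 * l ^ 2 := by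
    rw [← intervalIntegral.integral_add hNr (by apply Continuous.intervalIntegrable; fun_prop)]
    congr 1; ext x; ring
  rw [e4, e2]
  have e5 : (0 : ℝ) ^ 2 * (A' R * W R - u R * V R) - 0 ^ 2 * (A' (-R) * W (-R) - u (-R) * V (-R))
      - (∫ x in (-R)..R, 2 * N x * W x * (A' x * W x - u x * V x))
      + (∫ x in (-R)..R, N x ^ 2 * l ^ 2)
      = ∫ x in (-R)..R, (-(2 * N x * W x * (A' x * W x - u x * V x)) + N x ^ 2 * l ^ 2
        - (V x ^ 2 * N x ^ 2 - V x * N x ^ 3 / 3 + 2 * u x * V x * N x * W x)) := by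
    rw [intervalIntegral.integral_sub, e3, intervalIntegral.integral_add,
      intervalIntegral.integral_neg]
    · ring
    all_goals (apply Continuous.intervalIntegrable; fun_prop)
  rw [e5]
  -- Where `V ≥ l`, substituting `V = N + l` reduces the integrand to `2N A'W² + N³(2V/3 + l)`;
  -- elsewhere `N = 0`.
  have e6 : 0 ≤ ∫ x in (-R)..R, -(-(2 * N x * W x * (A' x * W x - u x * V x)) + N x ^ 2 * l ^ 2
        - (V x ^ 2 * N x ^ 2 - V x * N x ^ 3 / 3 + 2 * u x * V x * N x * W x)) := by
    apply intervalIntegral.integral_nonneg hRR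
    intro x _
    have hN0 : 0 ≤ N x := le_max_right _ _
    have hsum : 0 ≤ 2 * N x * (A' x * W x ^ 2) :=
      mul_nonneg (by positivity) (mul_nonneg (hA0 x) (sq_nonneg _))
    rcases le_total (V x - l) 0 with h | h
    · have : N x = 0 := max_eq_right h
      simp [this]
    · have hVN : V x = N x + l := by
        have : N x = V x - l := max_eq_left h
        linarith
      have h2 : 0 ≤ N x ^ 3 * (2 * V x / 3 + l) := by
        rw [hVN]; positivity
      have : -(-(2 * N x * W x * (A' x * W x - u x * V x)) + N x ^ 2 * l ^ 2
        - (V x ^ 2 * N x ^ 2 - V x * N x ^ 3 / 3 + 2 * u x * V x * N x * W x))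
        = 2 * N x * (A' x * W x ^ 2) + N x ^ 3 * (2 * V x / 3 + l) := by
        rw [hVN]; ring
      rw [this]; positivity
  rw [intervalIntegral.integral_neg] at e6
  linarith

/-- Sup bound and energy inequality on one time slice of a viscoplastic solution; `v`, `w` are the
first two space derivatives of `u`, `q` is the time derivative and `r` its space derivative. -/
theorem slice_estimates {ε : ℝ} (hε : 0 < ε) {u v w q r : ℝ → ℝ} (hu : Continuous u)
    (hv : MemLp v 2 volume) (hw : MemLp w 2 volume)
    (h1 : IsPrimitiveOn univ 0 u v) (h2 : IsPrimitiveOn univ 0 v w)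
    (h3 : IsPrimitiveOn univ 0 (fun x => flux ε (v x) - u x ^ 2 / 2) q)
    (h4 : IsPrimitiveOn univ 0 q r) :
    (∀ᵐ x, v x ^ 2 ≤ (∫ y, v y ^ 2) + ∫ y, w y ^ 2) ∧
      ∀ l : ℝ, 0 < l → ∫ x, (max (v x - l) 0) ^ 2 * (r x + l ^ 2) ≤ 0 := by
  obtain ⟨hvl, c1, hc1⟩ := h1
  obtain ⟨hwl, c2, hc2⟩ := h2
  obtain ⟨hql, c3, hc3⟩ := h3
  obtain ⟨hrl, c4, hc4⟩ := h4
  simp only [mem_univ, forall_const] at hc1 hc2 hc3 hc4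
  set V : ℝ → ℝ := fun x => c2 + ∫ z in (0 : ℝ)..x, w z with hVdef
  set Q : ℝ → ℝ := fun x => c4 + ∫ z in (0 : ℝ)..x, r z with hQdef
  have hVc : Continuous V := continuous_const_add_primitive hwl c2 0
  have hQc : Continuous Q := continuous_const_add_primitive hrl c4 0
  have hprim : ∀ {f : ℝ → ℝ}, Continuous f → ∀ c x,
      HasDerivAt (fun x => c + ∫ z in (0 : ℝ)..x, f z) (f x) x := fun {f} hf c x => by
    have := intervalIntegral.integral_hasDerivAt_right (hf.intervalIntegrable 0 x)
      (hf.stronglyMeasurableAtFilter volume _) hf.continuousAt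
    simpa using this.const_add c
  have hu' : ∀ x, HasDerivAt u (V x) x := by
    have : u = fun x => c1 + ∫ z in (0 : ℝ)..x, V z := by
      rw [← Continuous.ae_eq_iff_eq volume hu (continuous_const_add_primitive hVc.locallyIntegrable c1 0)]
      filter_upwards [hc1] with x hx
      rw [hx]; congr 1
      apply intervalIntegral.integral_congr_ae
      filter_upwards [hc2] with z hz _ using hz
    intro x; rw [this]; exact hprim hVc c1 x
  have hF' : ∀ x, HasDerivAt (fun x => flux ε (V x) - u x ^ 2 / 2) (Q x) x := by
    have : (fun x => flux ε (V x) - u x ^ 2 / 2) = fun x => c3 + ∫ z in (0 : ℝ)..x, Q z := by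
      rw [← Continuous.ae_eq_iff_eq volume (f := fun x => flux ε (V x) - u x ^ 2 / 2)
        (((continuous_flux hε).comp hVc).sub ((hu.pow 2).div_const 2))
        (continuous_const_add_primitive hQc.locallyIntegrable c3 0)]
      filter_upwards [hc3, hc2] with x hx hx2
      rw [show V x = v x from hx2.symm, hx]; congr 1
      apply intervalIntegral.integral_congr_ae
      filter_upwards [hc4] with z hz _ using hz
    intro x; rw [this]; exact hprim hQc c3 x
  -- This is the equation solved for the second derivative. Its right side is continuous, so the
  -- slice of `u` is classically `C²` and the energy computation applies.
  set W : ℝ → ℝ := fun x => (fluxDeriv ε (V x))⁻¹ * (Q x + u x * V x) with hWdef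
  have hAc : Continuous fun x => fluxDeriv ε (V x) := (continuous_fluxDeriv hε).comp hVc
  have hWc : Continuous W :=
    (hAc.inv₀ fun x => (fluxDeriv_pos hε _).ne').mul (hQc.add (hu.mul hVc))
  have hV' : ∀ x, HasDerivAt V (W x) x := fun x => by
    have hcomp : HasDerivAt (fun y => flux ε (V y)) (Q x + u x * V x) x := by
      have := (hF' x).add (((hu' x).pow 2).div_const 2)
      refine (this.congr_deriv ?_).congr_of_eventuallyEq (Eventually.of_forall fun y => ?_)
      · simp; ring
      · simp
    exact (hasStrictDerivAt_flux hε (V x)).hasDerivAt_of_comp (fluxDeriv_pos hε _).ne'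
      hVc.continuousAt hcomp
  have hVv : v =ᵐ[volume] V := hc2
  have hWw : w =ᵐ[volume] W := by
    filter_upwards [ae_hasDerivAt_primitive hwl c2 0] with x hx
    exact hx.unique (hV' x)
  have hVL : MemLp V 2 volume := (memLp_congr_ae hVv).mp hv
  have hWL : MemLp W 2 volume := (memLp_congr_ae hWw).mp hw
  obtain ⟨ht, hb⟩ := tendsto_sq_zero_of_memLp_two hVL hWL hV'
  constructor
  · have e1 : ∫ y, v y ^ 2 = ∫ y, V y ^ 2 := integral_congr_ae (hVv.mono fun y hy => by simp [hy])
    have e2 : ∫ y, w y ^ 2 = ∫ y, W y ^ 2 := integral_congr_ae (hWw.mono fun y hy => by simp [hy])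
    filter_upwards [hVv] with x hx
    rw [hx, e1, e2]
    exact sq_le_integral_of_hasDerivAt hVL hWL hV' x
  · intro l hl
    have e : ∫ x, (max (v x - l) 0) ^ 2 * (r x + l ^ 2)
        = ∫ x, (max (V x - l) 0) ^ 2 * (r x + l ^ 2) :=
      integral_congr_ae (hVv.mono fun y hy => by simp [hy])
    rw [e]
    refine integral_posPart_sq_mul_le_zero hl hu' hV' hWc hAc
      (fun x => (fluxDeriv_pos hε _).le) ht hb hrl c4 fun x => ?_
    have := (fluxDeriv_pos hε (V x)).ne'
    simp only [hWdef]
    field_simp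
    simp [hQdef]

/-! ### From weak partial derivatives to slices -/

theorem _root_.MeasureTheory.LocallyIntegrable.integrableOn_mul_snd {F : ℝ × ℝ → ℝ}
    (hF : LocallyIntegrable F volume) {b : ℝ → ℝ} (hb : Continuous b) (hbc : HasCompactSupport b)
    {K : Set ℝ} (hK : IsCompact K) :
    IntegrableOn (fun p : ℝ × ℝ => F p * b p.2) (K ×ˢ univ) volume := by
  have h1 : IntegrableOn (fun p : ℝ × ℝ => F p * b p.2) (K ×ˢ tsupport b) volume :=
    (hF.integrableOn_isCompact (hK.prod hbc.isCompact)).mul_continuousOn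
      (hb.comp continuous_snd).continuousOn (hK.prod hbc.isCompact)
  refine h1.of_forall_sdiff_eq_zero (hK.measurableSet.prod MeasurableSet.univ) ?_
  rintro ⟨s, y⟩ ⟨h, h'⟩
  have : y ∉ tsupport b := fun hy => h' ⟨h.1, hy⟩
  simp [image_eq_zero_of_notMem_tsupport this]

theorem ae_locallyIntegrable_slice {F : ℝ × ℝ → ℝ} (hF : LocallyIntegrable F volume) :
    ∀ᵐ s, LocallyIntegrable (fun y => F (s, y)) volume := by
  have h1 : ∀ n : ℕ, ∀ᵐ s, s ∈ Icc (-(n : ℝ)) n →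
      IntegrableOn (fun y => F (s, y)) (Icc (-(n : ℝ)) n) volume := by
    intro n
    have h := hF.integrableOn_isCompact
      ((isCompact_Icc (a := -(n : ℝ)) (b := n)).prod (isCompact_Icc (a := -(n : ℝ)) (b := n)))
    rw [IntegrableOn, Measure.volume_eq_prod, ← Measure.prod_restrict] at h
    exact (ae_restrict_iff' measurableSet_Icc).mp h.prod_right_ae
  filter_upwards [ae_all_iff.mpr h1] with s hs
  rw [locallyIntegrable_iff]
  intro K hK
  obtain ⟨R, hR⟩ := hK.isBounded.subset_closedBall (0 : ℝ)
  obtain ⟨n, hn⟩ := exists_nat_ge (max R |s|)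
  have hs' : s ∈ Icc (-(n : ℝ)) n := abs_le.mp ((le_max_right _ _).trans hn)
  refine (hs n hs').mono_set (hR.trans ?_)
  rw [Real.closedBall_eq_Icc]
  have := (le_max_left _ _).trans hn
  exact Icc_subset_Icc (by linarith) (by linarith)

/-- For each compact `K` there is a countable family of test functions supported in `K ∩ Y`
which is dense for the `C¹` norm. -/
theorem exists_countable_dense_test (Y K : Set ℝ) (hK : IsCompact K) :
    ∃ d : ℕ → ℝ → ℝ, (∀ n, ContDiff ℝ ∞ (d n) ∧ HasCompactSupport (d n) ∧ tsupport (d n) ⊆ Y ∧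
      tsupport (d n) ⊆ K) ∧
      ∀ b : ℝ → ℝ, ContDiff ℝ ∞ b → tsupport b ⊆ Y → tsupport b ⊆ K → ∀ δ : ℝ, 0 < δ →
        ∃ n, ∀ y, |b y - d n y| ≤ δ ∧ |deriv b y - deriv (d n) y| ≤ δ := by
  have : CompactSpace K := isCompact_iff_compactSpace.mp hK
  let B := {b : ℝ → ℝ // ContDiff ℝ ∞ b ∧ HasCompactSupport b ∧ tsupport b ⊆ Y ∧ tsupport b ⊆ K}
  let ι : B → C(K, ℝ) × C(K, ℝ) := fun b =>
    (⟨fun y => b.1 y, b.2.1.continuous.comp continuous_subtype_val⟩,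
     ⟨fun y => deriv b.1 y, (b.2.1.continuous_deriv (by simp)).comp continuous_subtype_val⟩)
  have hne : Nonempty (range ι) := ⟨⟨ι ⟨0, contDiff_const, HasCompactSupport.zero,
    by simp, by simp⟩, mem_range_self _⟩⟩
  obtain ⟨e, he⟩ := TopologicalSpace.exists_dense_seq (range ι)
  choose d hd using fun n => (e n).2
  refine ⟨fun n => (d n).1, fun n => (d n).2, fun b hb hbY hbK δ hδ => ?_⟩
  have hbc : HasCompactSupport b := hK.of_isClosed_subset (isClosed_tsupport b) hbK
  obtain ⟨n, hn⟩ := he.exists_dist_lt (⟨ι ⟨b, hb, hbc, hbY, hbK⟩, mem_range_self _⟩ : range ι) hδ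
  refine ⟨n, fun y => ?_⟩
  rw [Subtype.dist_eq, ← hd n, Prod.dist_eq, max_lt_iff] at hn
  by_cases hy : y ∈ K
  · have h1 := (ContinuousMap.dist_lt_iff hδ).mp hn.1 ⟨y, hy⟩
    have h2 := (ContinuousMap.dist_lt_iff hδ).mp hn.2 ⟨y, hy⟩
    rw [Real.dist_eq] at h1 h2
    exact ⟨h1.le, h2.le⟩
  · have h1 : y ∉ tsupport b := fun h => hy (hbK h)
    have h2 : y ∉ tsupport (d n).1 := fun h => hy ((d n).2.2.2.2 h)
    have h3 : y ∉ tsupport (deriv b) := fun h => h1 (tsupport_deriv_subset (𝕜 := ℝ) h)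
    have h4 : y ∉ tsupport (deriv (d n).1) := fun h => h2 (tsupport_deriv_subset (𝕜 := ℝ) h)
    simp only
    rw [image_eq_zero_of_notMem_tsupport h1, image_eq_zero_of_notMem_tsupport h2,
      image_eq_zero_of_notMem_tsupport h3, image_eq_zero_of_notMem_tsupport h4]
    simp [hδ.le]

/-- A locally integrable function with a locally integrable weak partial derivative in the second
variable is a primitive of it on almost every slice. -/
theorem ae_isPrimitiveOn_slice {S Y : Set ℝ} (hS : IsOpen S) (hY : IsOpen Y) (hYc : Y.OrdConnected)
    {y₀ : ℝ} (hy₀ : y₀ ∈ Y) {f g : ℝ × ℝ → ℝ} (hf : LocallyIntegrable f volume)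
    (hg : LocallyIntegrable g volume)
    (h : ∀ a b : ℝ → ℝ, ContDiff ℝ ∞ a → HasCompactSupport a → tsupport a ⊆ S →
      ContDiff ℝ ∞ b → HasCompactSupport b → tsupport b ⊆ Y →
      ∫ p : ℝ × ℝ, f p * (a p.1 * deriv b p.2) = -∫ p : ℝ × ℝ, g p * (a p.1 * b p.2)) :
    ∀ᵐ s, s ∈ S → IsPrimitiveOn Y y₀ (fun y => f (s, y)) (fun y => g (s, y)) := by
  -- For fixed `b`, arbitrariness of `a` localizes the identity in `s`; here the null set still
  -- depends on `b`.
  have hone : ∀ b : ℝ → ℝ, ContDiff ℝ ∞ b → HasCompactSupport b → tsupport b ⊆ Y →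
      ∀ᵐ s, s ∈ S → ∫ y, (f (s, y) * deriv b y + g (s, y) * b y) = 0 := by
    intro b hb hbc hbY
    have hdb : Continuous (deriv b) := hb.continuous_deriv (by simp)
    have hint : ∀ K : Set ℝ, IsCompact K → IntegrableOn
        (fun p : ℝ × ℝ => f p * deriv b p.2 + g p * b p.2) (K ×ˢ univ) volume := fun K hK =>
      (hf.integrableOn_mul_snd hdb hbc.deriv hK).add (hg.integrableOn_mul_snd hb.continuous hbc hK)
    refine hS.ae_eq_zero_of_integral_contDiff_smul_eq_zero ?_ ?_
    · refine LocallyIntegrable.locallyIntegrableOn ?_ S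
      rw [locallyIntegrable_iff]
      intro K hK
      have := hint K hK
      rw [IntegrableOn, Measure.volume_eq_prod, ← Measure.prod_restrict, Measure.restrict_univ]
        at this
      exact this.integral_prod_left
    · intro a ha hac haS
      have hia : ∀ F : ℝ × ℝ → ℝ, LocallyIntegrable F volume → ∀ β : ℝ → ℝ, Continuous β →
          HasCompactSupport β → Integrable (fun p : ℝ × ℝ => F p * (a p.1 * β p.2)) volume := by
        intro F hF β hβ hβc
        have := hF.integrable_smul_left_of_hasCompactSupport
          (g := fun p : ℝ × ℝ => a p.1 * β p.2)
          ((ha.continuous.comp continuous_fst).mul (hβ.comp continuous_snd)) (by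
            refine HasCompactSupport.intro (hac.isCompact.prod hβc.isCompact) ?_
            rintro ⟨s, y⟩ hp
            by_contra hcon
            have h0 := mul_ne_zero_iff.mp hcon
            exact hp ⟨subset_tsupport _ h0.1, subset_tsupport _ h0.2⟩)
        simpa [mul_comm] using this
      have i1 := hia f hf _ hdb hbc.deriv
      have i2 := hia g hg _ hb.continuous hbc
      have h0 : ∫ p : ℝ × ℝ, (f p * (a p.1 * deriv b p.2) + g p * (a p.1 * b p.2)) = 0 := by
        rw [integral_add i1 i2, h a b ha hac haS hb hbc hbY]; ring
      rw [Measure.volume_eq_prod, integral_prod _ (by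
        rw [← Measure.volume_eq_prod]; exact i1.add i2)] at h0
      rw [← h0]
      congr 1; ext s
      rw [smul_eq_mul, ← integral_const_mul]
      congr 1; ext y; ring
  -- A countable `C¹`-dense family makes the null set independent of `b`, since both sides are
  -- continuous in `b` for the `C¹` norm on a fixed compact set.
  have hcount : ∀ n : ℕ, ∀ᵐ s, s ∈ S → LocallyIntegrable (fun y => f (s, y)) volume →
      LocallyIntegrable (fun y => g (s, y)) volume → ∀ b : ℝ → ℝ, ContDiff ℝ ∞ b →
      tsupport b ⊆ Y → tsupport b ⊆ Icc (-(n : ℝ)) n →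
      ∫ y, (f (s, y) * deriv b y + g (s, y) * b y) = 0 := by
    intro n
    obtain ⟨d, hd, hdense⟩ := exists_countable_dense_test Y (Icc (-(n : ℝ)) n) isCompact_Icc
    have hall := ae_all_iff.mpr fun k => hone (d k) (hd k).1 (hd k).2.1 (hd k).2.2.1
    filter_upwards [hall] with s hs hsS hfs hgs b hb hbY hbK
    have hbc : HasCompactSupport b := isCompact_Icc.of_isClosed_subset (isClosed_tsupport b) hbK
    have hfi := hfs.integrableOn_isCompact (isCompact_Icc (a := -(n : ℝ)) (b := n))
    have hgi := hgs.integrableOn_isCompact (isCompact_Icc (a := -(n : ℝ)) (b := n))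
    set M := ∫ y in Icc (-(n : ℝ)) n, (|f (s, y)| + |g (s, y)|) with hM
    have hM0 : 0 ≤ M := integral_nonneg fun y => by simp only [Pi.zero_apply]; positivity
    have hprod : ∀ b : ℝ → ℝ, ContDiff ℝ ∞ b → HasCompactSupport b →
        Integrable (fun y => f (s, y) * deriv b y + g (s, y) * b y) volume := by
      intro b hb hbc
      have i1 := hfs.integrable_smul_left_of_hasCompactSupport
        (hb.continuous_deriv (by simp)) hbc.deriv
      have i2 := hgs.integrable_smul_left_of_hasCompactSupport hb.continuous hbc
      refine (i1.add i2).congr (Eventually.of_forall fun y => ?_)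
      simp only [Pi.add_apply, smul_eq_mul]; ring
    have hbound : ∀ δ : ℝ, 0 < δ →
        |∫ y, (f (s, y) * deriv b y + g (s, y) * b y)| ≤ δ * M := by
      intro δ hδ
      obtain ⟨k, hk⟩ := hdense b hb hbY hbK δ hδ
      have e1 : ∫ y, (f (s, y) * deriv b y + g (s, y) * b y)
          = ∫ y, (f (s, y) * (deriv b y - deriv (d k) y) + g (s, y) * (b y - d k y)) := by
        rw [← sub_zero (∫ y, (f (s, y) * deriv b y + g (s, y) * b y)), ← hs k hsS,
          ← integral_sub (hprod b hb hbc) (hprod _ (hd k).1 (hd k).2.1)]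
        congr 1; ext y; ring
      have e2 : ∫ y, (f (s, y) * (deriv b y - deriv (d k) y) + g (s, y) * (b y - d k y))
          = ∫ y in Icc (-(n : ℝ)) n,
            (f (s, y) * (deriv b y - deriv (d k) y) + g (s, y) * (b y - d k y)) := by
        rw [setIntegral_eq_integral_of_forall_compl_eq_zero]
        intro y hy
        have h1 : y ∉ tsupport b := fun h => hy (hbK h)
        have h2 : y ∉ tsupport (d k) := fun h => hy ((hd k).2.2.2 h)
        have h3 : y ∉ tsupport (deriv b) := fun h => h1 (tsupport_deriv_subset (𝕜 := ℝ) h)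
        have h4 : y ∉ tsupport (deriv (d k)) := fun h => h2 (tsupport_deriv_subset (𝕜 := ℝ) h)
        rw [image_eq_zero_of_notMem_tsupport h1, image_eq_zero_of_notMem_tsupport h2,
          image_eq_zero_of_notMem_tsupport h3, image_eq_zero_of_notMem_tsupport h4]
        simp
      rw [e1, e2, hM, ← integral_const_mul, ← Real.norm_eq_abs]
      refine norm_integral_le_of_norm_le ((hfi.abs.add hgi.abs).const_mul δ)
        (Eventually.of_forall fun y => ?_)
      rw [Real.norm_eq_abs]
      calc |f (s, y) * (deriv b y - deriv (d k) y) + g (s, y) * (b y - d k y)|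
          ≤ |f (s, y)| * |deriv b y - deriv (d k) y| + |g (s, y)| * |b y - d k y| := by
            rw [← abs_mul, ← abs_mul]; exact abs_add_le _ _
        _ ≤ |f (s, y)| * δ + |g (s, y)| * δ := by
            gcongr
            · exact (hk y).2
            · exact (hk y).1
        _ = δ * (|f (s, y)| + |g (s, y)|) := by ring
    by_contra hne
    have hpos : 0 < |∫ y, (f (s, y) * deriv b y + g (s, y) * b y)| := abs_pos.mpr hne
    have h1 := hbound (|∫ y, (f (s, y) * deriv b y + g (s, y) * b y)| / (2 * (M + 1)))
      (by positivity)
    have h2 : |∫ y, (f (s, y) * deriv b y + g (s, y) * b y)| / (2 * (M + 1)) * M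
        < |∫ y, (f (s, y) * deriv b y + g (s, y) * b y)| := by
      rw [div_mul_eq_mul_div, div_lt_iff₀ (by positivity)]
      nlinarith
    linarith
  filter_upwards [ae_all_iff.mpr hcount, ae_locallyIntegrable_slice hf,
    ae_locallyIntegrable_slice hg] with s hs hfs hgs hsS
  refine isPrimitiveOn_of_weak hY hYc hy₀ hfs hgs fun b hb hbc hbY => ?_
  obtain ⟨R, hR⟩ := hbc.isCompact.isBounded.subset_closedBall (0 : ℝ)
  obtain ⟨n, hn⟩ := exists_nat_ge R
  have hbK : tsupport b ⊆ Icc (-(n : ℝ)) n := by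
    refine hR.trans ?_
    rw [Real.closedBall_eq_Icc]
    exact Icc_subset_Icc (by linarith) (by linarith)
  have h0 := hs n hsS hfs hgs b hb hbY hbK
  have i1 := hfs.integrable_smul_left_of_hasCompactSupport
    (hb.continuous_deriv (by simp)) hbc.deriv
  have i2 := hgs.integrable_smul_left_of_hasCompactSupport hb.continuous hbc
  simp only [smul_eq_mul] at i1 i2
  rw [integral_add (by simpa [mul_comm] using i1) (by simpa [mul_comm] using i2)] at h0
  linarith

/-! ### Weak derivatives on the half-plane -/

/-- Extension by zero to nonpositive times. -/
noncomputable def extZero (f : ℝ → ℝ → ℝ) : ℝ × ℝ → ℝ :=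
  indicator (Ioi 0 ×ˢ univ) (Function.uncurry f)

theorem measurableSet_halfPlane : MeasurableSet (Ioi (0 : ℝ) ×ˢ (univ : Set ℝ)) :=
  measurableSet_Ioi.prod MeasurableSet.univ

theorem extZero_of_pos (f : ℝ → ℝ → ℝ) {t : ℝ} (ht : 0 < t) (x : ℝ) :
    extZero f (t, x) = f t x := by
  simp [extZero, ht]

theorem integral_extZero_mul (f : ℝ → ℝ → ℝ) (k : ℝ × ℝ → ℝ) :
    ∫ p : ℝ × ℝ, extZero f p * k p
      = ∫ p in Ioi (0 : ℝ) ×ˢ (univ : Set ℝ), f p.1 p.2 * k p := by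
  rw [← integral_indicator measurableSet_halfPlane]
  congr 1; ext p
  by_cases hp : p ∈ Ioi (0 : ℝ) ×ˢ (univ : Set ℝ)
  · simp [extZero, indicator_of_mem hp, Function.uncurry]
  · simp [extZero, indicator_of_notMem hp]

theorem MemLinftyL2.memLp {T : ℝ} {f : ℝ → ℝ → ℝ} (h : MemLinftyL2 T f) :
    MemLp (Function.uncurry f) 2 (volume.restrict (strip T)) := by
  obtain ⟨hm, M, hM⟩ := h
  refine ⟨hm, ?_⟩
  rw [eLpNorm_lt_top_iff_lintegral_rpow_enorm_lt_top (by norm_num) (by norm_num)]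
  have hvol : (volume.restrict (strip T) : Measure (ℝ × ℝ))
      = (volume.restrict (Ioo 0 T)).prod volume := by
    rw [strip, Measure.volume_eq_prod, ← Measure.prod_restrict, Measure.restrict_univ]
  rw [hvol] at hm ⊢
  rw [lintegral_prod _ (hm.enorm.pow_const _)]
  calc ∫⁻ t in Ioo 0 T, ∫⁻ x, ‖Function.uncurry f (t, x)‖ₑ ^ (2 : ℝ≥0∞).toReal
      ≤ ∫⁻ t in Ioo 0 T, (M : ℝ≥0∞) ^ (2 : ℝ) := by
        refine lintegral_mono_ae (hM.mono fun t ht => ?_)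
        rw [eLpNorm_eq_lintegral_rpow_enorm_toReal (by norm_num) (by norm_num)] at ht
        have := ENNReal.rpow_le_rpow ht (z := 2) (by norm_num)
        rw [← ENNReal.rpow_mul] at this
        simpa using this
    _ < ⊤ := by
        rw [lintegral_const]
        refine ENNReal.mul_lt_top (ENNReal.rpow_lt_top_of_nonneg (by norm_num) (by simp)) ?_
        simp

/-- The bounds hold up to time zero, so extension by zero stays integrable across it and the slicing
lemma for the whole plane applies. -/
theorem locallyIntegrable_extZero {f : ℝ → ℝ → ℝ}
    (h : ∀ T : ℝ, 0 < T → ∀ K : Set (ℝ × ℝ), IsCompact K →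
      IntegrableOn (Function.uncurry f) (strip T ∩ K) volume) :
    LocallyIntegrable (extZero f) volume := by
  rw [locallyIntegrable_iff]
  intro K hK
  obtain ⟨R, hR⟩ := hK.isBounded.subset_closedBall (0 : ℝ × ℝ)
  rw [extZero, integrableOn_indicator_iff measurableSet_halfPlane]
  refine (h (|R| + 1) (by positivity) K hK).mono_set ?_
  rintro ⟨t, x⟩ ⟨hp, hpK⟩
  refine ⟨⟨⟨hp.1, ?_⟩, mem_univ _⟩, hpK⟩
  have h1 := hR hpK
  rw [mem_closedBall_zero_iff, Prod.norm_def, max_le_iff] at h1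
  simp only [Real.norm_eq_abs] at h1
  linarith [le_abs_self t, le_abs_self R]

theorem locallyIntegrable_extZero_of_memLp {f : ℝ → ℝ → ℝ}
    (h : ∀ T : ℝ, 0 < T → MemLp (Function.uncurry f) 2 (volume.restrict (strip T))) :
    LocallyIntegrable (extZero f) volume := by
  refine locallyIntegrable_extZero fun T hT K hK => ?_
  have h1 : MemLp (Function.uncurry f) 2 (volume.restrict (strip T ∩ K)) :=
    (h T hT).mono_measure (Measure.restrict_mono inter_subset_left le_rfl)
  have : IsFiniteMeasure (volume.restrict (strip T ∩ K) : Measure (ℝ × ℝ)) :=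
    ⟨by rw [Measure.restrict_apply_univ]
        exact (measure_mono inter_subset_right).trans_lt hK.measure_lt_top⟩
  exact h1.integrable (by norm_num)

theorem fderiv_tensor_apply {a b : ℝ → ℝ} (ha : ContDiff ℝ ∞ a) (hb : ContDiff ℝ ∞ b) (p : ℝ × ℝ) :
    fderiv ℝ (fun p : ℝ × ℝ => a p.1 * b p.2) p (1, 0) = deriv a p.1 * b p.2 ∧
    fderiv ℝ (fun p : ℝ × ℝ => a p.1 * b p.2) p (0, 1) = a p.1 * deriv b p.2 := by
  have h1 : HasFDerivAt (fun p : ℝ × ℝ => a p.1) _ p :=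
    ((ha.differentiable (by simp)) p.1).hasDerivAt.hasFDerivAt.comp p hasFDerivAt_fst
  have h2 : HasFDerivAt (fun p : ℝ × ℝ => b p.2) _ p :=
    ((hb.differentiable (by simp)) p.2).hasDerivAt.hasFDerivAt.comp p hasFDerivAt_snd
  rw [HasFDerivAt.fderiv (f := fun p : ℝ × ℝ => a p.1 * b p.2) (h1.mul h2)]
  constructor <;> simp [mul_comm]

theorem tsupport_tensor_subset (a b : ℝ → ℝ) :
    tsupport (fun p : ℝ × ℝ => a p.1 * b p.2) ⊆ tsupport a ×ˢ tsupport b := by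
  refine closure_minimal ?_ ((isClosed_tsupport a).prod (isClosed_tsupport b))
  rintro ⟨s, y⟩ hp
  have h0 := mul_ne_zero_iff.mp hp
  exact ⟨subset_tsupport _ h0.1, subset_tsupport _ h0.2⟩

theorem IsWeakPartial.ae_isPrimitiveOn_snd {f g : ℝ → ℝ → ℝ} (h : IsWeakPartial (0, 1) f g)
    (hf : LocallyIntegrable (extZero f) volume) (hg : LocallyIntegrable (extZero g) volume) :
    ∀ᵐ t : ℝ, 0 < t → IsPrimitiveOn univ 0 (f t) (g t) := by
  have := ae_isPrimitiveOn_slice (S := Ioi 0) (Y := univ) isOpen_Ioi isOpen_univ ordConnected_univ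
    (mem_univ (0 : ℝ)) hf hg (fun a b ha hac haS hb hbc _ => by
      rw [integral_extZero_mul, integral_extZero_mul]
      have hs := tsupport_tensor_subset a b
      have := h (fun p => a p.1 * b p.2) ((ha.comp contDiff_fst).mul (hb.comp contDiff_snd))
        ((hac.isCompact.prod hbc.isCompact).of_isClosed_subset (isClosed_tsupport _) hs)
        (hs.trans (prod_mono haS (subset_univ _)))
      simp_rw [(fderiv_tensor_apply ha hb _).2] at this
      exact this)
  filter_upwards [this] with t ht hpos
  have h2 := ht hpos
  simp_rw [extZero_of_pos _ hpos] at h2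
  exact h2

theorem _root_.MeasureTheory.LocallyIntegrable.comp_swap {F : ℝ × ℝ → ℝ}
    (hF : LocallyIntegrable F volume) : LocallyIntegrable (fun p : ℝ × ℝ => F p.swap) volume := by
  rw [locallyIntegrable_iff]
  intro K hK
  have hK2 : IsCompact (Prod.swap '' K) := hK.image continuous_swap
  have h1 := hF.integrableOn_isCompact hK2
  have hmp : MeasurePreserving (Prod.swap : ℝ × ℝ → ℝ × ℝ) volume volume :=
    Measure.measurePreserving_swap
  have h2 := (hmp.integrableOn_comp_preimage
    (MeasurableEquiv.prodComm : ℝ × ℝ ≃ᵐ ℝ × ℝ).measurableEmbedding (f := F)).mpr h1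
  rwa [preimage_image_eq _ Prod.swap_injective] at h2

theorem IsWeakPartial.ae_isPrimitiveOn_fst {f g : ℝ → ℝ → ℝ} (h : IsWeakPartial (1, 0) f g)
    (hf : LocallyIntegrable (extZero f) volume) (hg : LocallyIntegrable (extZero g) volume) :
    ∀ᵐ x : ℝ, IsPrimitiveOn (Ioi 0) 1 (fun t => extZero f (t, x)) (fun t => extZero g (t, x)) := by
  have hmp : MeasurePreserving (Prod.swap : ℝ × ℝ → ℝ × ℝ) volume volume :=
    Measure.measurePreserving_swap
  have hsw : ∀ k : ℝ × ℝ → ℝ, ∫ p : ℝ × ℝ, k p.swap = ∫ p : ℝ × ℝ, k p := fun k =>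
    hmp.integral_comp (MeasurableEquiv.prodComm : ℝ × ℝ ≃ᵐ ℝ × ℝ).measurableEmbedding k
  have := ae_isPrimitiveOn_slice (S := univ) (Y := Ioi 0) isOpen_univ isOpen_Ioi ordConnected_Ioi
    (show (1 : ℝ) ∈ Ioi (0 : ℝ) by simp) hf.comp_swap hg.comp_swap
    (fun b a hb hbc _ ha hac haS => by
      have e1 := hsw (fun p => extZero f p * (b p.2 * deriv a p.1))
      have e2 := hsw (fun p => extZero g p * (b p.2 * a p.1))
      simp only [Prod.fst_swap, Prod.snd_swap] at e1 e2
      rw [e1, e2, integral_extZero_mul, integral_extZero_mul]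
      have hs := tsupport_tensor_subset a b
      have := h (fun p => a p.1 * b p.2) ((ha.comp contDiff_fst).mul (hb.comp contDiff_snd))
        ((hac.isCompact.prod hbc.isCompact).of_isClosed_subset (isClosed_tsupport _) hs)
        (hs.trans (prod_mono haS (subset_univ _)))
      simp_rw [(fderiv_tensor_apply ha hb _).1] at this
      simpa only [mul_comm (b _)] using this)
  filter_upwards [this] with x hx
  exact hx (mem_univ _)

theorem contDiff_fderiv_apply {φ : ℝ × ℝ → ℝ} (hφ : ContDiff ℝ ∞ φ) (e : ℝ × ℝ) :
    ContDiff ℝ ∞ fun p => fderiv ℝ φ p e :=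
  (hφ.fderiv_right (m := ∞) (by simp)).clm_apply contDiff_const

theorem tsupport_fderiv_apply_subset_tsupport (φ : ℝ × ℝ → ℝ) (e : ℝ × ℝ) :
    tsupport (fun p => fderiv ℝ φ p e) ⊆ tsupport φ :=
  (closure_mono fun p hp => by
    rw [Function.mem_support] at hp ⊢
    intro h; exact hp (by simp [h])).trans (tsupport_fderiv_subset ℝ)

theorem fderiv_fderiv_apply_comm {φ : ℝ × ℝ → ℝ} (hφ : ContDiff ℝ ∞ φ) (e e' p : ℝ × ℝ) :
    fderiv ℝ (fun p => fderiv ℝ φ p e) p e' = fderiv ℝ (fun p => fderiv ℝ φ p e') p e := by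
  have hd : DifferentiableAt ℝ (fderiv ℝ φ) p :=
    ((hφ.fderiv_right (m := ∞) (by simp)).differentiable (by simp)) p
  have hs : IsSymmSndFDerivAt ℝ φ p :=
    (hφ.contDiffAt).isSymmSndFDerivAt (by
      rw [minSmoothness_of_isRCLikeNormedField]; exact WithTop.coe_le_coe.mpr le_top)
  have hk : ∀ v : ℝ × ℝ, fderiv ℝ (fun p => fderiv ℝ φ p v) p
      = (fderiv ℝ (fderiv ℝ φ) p).flip v := fun v => by
    rw [fderiv_clm_apply hd (differentiableAt_const v)]; simp
  rw [hk, hk]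
  simpa using hs.eq e' e

/-- Weak partial derivatives commute. -/
theorem IsWeakPartial.comm {e e' : ℝ × ℝ} {u v q r : ℝ → ℝ → ℝ} (h1 : IsWeakPartial e u v)
    (h2 : IsWeakPartial e' u q) (h3 : IsWeakPartial e q r) : IsWeakPartial e' v r := by
  intro φ hφ hc hs
  have hc' : ∀ e, HasCompactSupport fun p => fderiv ℝ φ p e := fun e =>
    hc.isCompact.of_isClosed_subset (isClosed_tsupport _) (tsupport_fderiv_apply_subset_tsupport φ e)
  have a1 := h1 _ (contDiff_fderiv_apply hφ e') (hc' e')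
    ((tsupport_fderiv_apply_subset_tsupport φ e').trans hs)
  have a2 := h2 _ (contDiff_fderiv_apply hφ e) (hc' e)
    ((tsupport_fderiv_apply_subset_tsupport φ e).trans hs)
  have a3 := h3 φ hφ hc hs
  simp_rw [fderiv_fderiv_apply_comm hφ e' e] at a1
  linarith

theorem abs_flux_le {ε : ℝ} (hε : 0 < ε) (p : ℝ) : |flux ε p| ≤ 1 + ε * |p| := by
  unfold flux
  refine (abs_add_le _ _).trans ?_
  rw [abs_mul, abs_of_pos hε, abs_div, abs_of_nonneg (Real.sqrt_nonneg _)]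
  have : |p| / √(p ^ 2 + ε ^ 2) ≤ 1 := by
    rw [div_le_one (by positivity), ← Real.sqrt_sq_eq_abs]
    exact Real.sqrt_le_sqrt (by nlinarith [sq_nonneg ε])
  linarith

theorem locallyIntegrable_extZero_flux {ε : ℝ} (hε : 0 < ε) {u v : ℝ → ℝ → ℝ}
    (hu : ∀ T : ℝ, 0 < T → MemLp (Function.uncurry u) 2 (volume.restrict (strip T)))
    (hv : ∀ T : ℝ, 0 < T → MemLp (Function.uncurry v) 2 (volume.restrict (strip T))) :
    LocallyIntegrable (extZero fun t x => flux ε (v t x) - u t x ^ 2 / 2) volume := by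
  refine locallyIntegrable_extZero fun T hT K hK => ?_
  have hle : (volume.restrict (strip T ∩ K) : Measure (ℝ × ℝ)) ≤ volume.restrict (strip T) :=
    Measure.restrict_mono inter_subset_left le_rfl
  have : IsFiniteMeasure (volume.restrict (strip T ∩ K) : Measure (ℝ × ℝ)) :=
    ⟨by rw [Measure.restrict_apply_univ]
        exact (measure_mono inter_subset_right).trans_lt hK.measure_lt_top⟩
  have h1 : Integrable (Function.uncurry v) (volume.restrict (strip T ∩ K)) :=
    ((hv T hT).mono_measure hle).integrable (by norm_num)
  have h2 : Integrable (fun p => Function.uncurry u p ^ 2) (volume.restrict (strip T ∩ K)) :=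
    ((hu T hT).mono_measure hle).integrable_sq
  have h3 : Integrable (fun p => flux ε (Function.uncurry v p))
      (volume.restrict (strip T ∩ K)) := by
    refine ((integrable_const (1 : ℝ)).add (h1.abs.const_mul ε)).mono'
      ((continuous_flux hε).comp_aestronglyMeasurable h1.aestronglyMeasurable)
      (Eventually.of_forall fun p => ?_)
    exact abs_flux_le hε _
  exact h3.sub (h2.div_const 2)

/-- Test functions supported in positive times do not see the initial datum; replacing the time term
by `q` turns the integral equation into a statement about the space derivative of the total flux. -/
theorem isWeakPartial_flux {ε : ℝ} (hε : 0 < ε) {uin : ℝ → ℝ} {u v q : ℝ → ℝ → ℝ}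
    (hu : ∀ T : ℝ, 0 < T → MemLp (Function.uncurry u) 2 (volume.restrict (strip T)))
    (hv : ∀ T : ℝ, 0 < T → MemLp (Function.uncurry v) 2 (volume.restrict (strip T)))
    (hq : IsWeakPartial (1, 0) u q)
    (heq : ∀ φ : ℝ × ℝ → ℝ, ContDiff ℝ 1 φ → HasCompactSupport φ →
      (∫ p in Ioi (0 : ℝ) ×ˢ (univ : Set ℝ),
        (u p.1 p.2 * fderiv ℝ φ p (1, 0) +
          ((u p.1 p.2) ^ 2 / 2 - ε * v p.1 p.2
            - v p.1 p.2 / Real.sqrt ((v p.1 p.2) ^ 2 + ε ^ 2)) * fderiv ℝ φ p (0, 1)))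
      + ∫ x, uin x * φ (0, x) = 0) :
    IsWeakPartial (0, 1) (fun t x => flux ε (v t x) - u t x ^ 2 / 2) q := by
  intro φ hφ hc hs
  have h1 := heq φ (hφ.of_le (by simp)) hc
  have h0 : ∀ x, φ (0, x) = 0 := fun x =>
    image_eq_zero_of_notMem_tsupport fun h => lt_irrefl (0 : ℝ) (hs h).1
  simp only [h0, mul_zero, integral_zero, add_zero] at h1
  have hint : ∀ (f : ℝ → ℝ → ℝ) (e : ℝ × ℝ), LocallyIntegrable (extZero f) volume →
      IntegrableOn (fun p : ℝ × ℝ => f p.1 p.2 * fderiv ℝ φ p e)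
        (Ioi (0 : ℝ) ×ˢ (univ : Set ℝ)) volume := fun f e hf => by
    have := (hf.integrable_smul_left_of_hasCompactSupport
      (contDiff_fderiv_apply hφ e).continuous (hc.isCompact.of_isClosed_subset
        (isClosed_tsupport _) (tsupport_fderiv_apply_subset_tsupport φ e))).integrableOn
        (s := Ioi (0 : ℝ) ×ˢ (univ : Set ℝ))
    refine this.congr_fun (fun p hp => ?_) measurableSet_halfPlane
    simp only [smul_eq_mul, extZero, indicator_of_mem hp, Function.uncurry]
    ring
  have i1 := hint u (1, 0) (locallyIntegrable_extZero_of_memLp hu)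
  have i2 := hint _ (0, 1) (locallyIntegrable_extZero_flux hε hu hv)
  have h2 := integral_sub i1 i2
  rw [hq φ hφ hc hs] at h2
  have h3 : ∫ p in Ioi (0 : ℝ) ×ˢ (univ : Set ℝ), (u p.1 p.2 * fderiv ℝ φ p (1, 0)
      - (flux ε (v p.1 p.2) - u p.1 p.2 ^ 2 / 2) * fderiv ℝ φ p (0, 1)) = 0 := by
    refine Eq.trans ?_ h1
    refine integral_congr_ae (Eventually.of_forall fun p => ?_)
    simp only [flux]; ring
  rw [h3] at h2
  linarith

/-! ### Comparison with the barrier `1/t` -/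

theorem forall_le_of_ae_of_continuousOn {α : Type*} [TopologicalSpace α] [MeasurableSpace α]
    {μ : Measure α} [μ.IsOpenPosMeasure] {U : Set α} (hU : IsOpen U) {f g : α → ℝ}
    (hf : ContinuousOn f U) (hg : ContinuousOn g U) (h : ∀ᵐ x ∂μ, x ∈ U → f x ≤ g x) :
    ∀ x ∈ U, f x ≤ g x := by
  intro x hx
  by_contra hcon
  push Not at hcon
  have hopen : IsOpen (U ∩ (fun x => f x - g x) ⁻¹' Ioi 0) :=
    (hf.sub hg).isOpen_inter_preimage hU isOpen_Ioi
  have hnull : μ (U ∩ (fun x => f x - g x) ⁻¹' Ioi 0) = 0 := by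
    refine measure_mono_null ?_ h
    rintro y ⟨hyU, hy⟩ hall
    have := hall hyU
    simp only [mem_preimage, mem_Ioi] at hy
    linarith
  have := (hopen.measure_eq_zero_iff μ).mp hnull
  have hmem : x ∈ U ∩ (fun x => f x - g x) ⁻¹' Ioi 0 := ⟨hx, by
    simp only [mem_preimage, mem_Ioi]; linarith⟩
  rw [this] at hmem
  exact hmem

/-- The evolution of `(V - 1/t)₊³ / 3` in time, integrated against the weight `T - t`. -/
theorem integral_posPart_cube_eq {g : ℝ → ℝ} (hg : LocallyIntegrable g volume) (c y₀ : ℝ) {a T : ℝ}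
    (ha : 0 < a) (haT : a < T) (hle : c + ∫ z in y₀..a, g z ≤ 1 / a) :
    ∫ t in a..T, (max (c + (∫ z in y₀..t, g z) - 1 / t) 0) ^ 3 / 3
      = ∫ t in a..T, (max (c + (∫ z in y₀..t, g z) - 1 / t) 0) ^ 2 * (g t + (1 / t) ^ 2)
        * (T - t) := by
  have hpos : ∀ t ∈ uIcc a T, 0 < t := fun t ht => by
    rw [uIcc_of_le haT.le] at ht; exact ha.trans_le ht.1
  have hinv : AbsolutelyContinuousOnInterval (fun t : ℝ => 1 / t) a T :=
    (contDiffOn_const.div contDiffOn_id fun t ht => (hpos t ht).ne').absolutelyContinuousOnInterval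
  have hA := (absolutelyContinuousOnInterval_primitive hg c y₀ a T).fun_sub hinv
  have hlip : LipschitzWith 1 fun s : ℝ => max s 0 := LipschitzWith.id.max_const 0
  have hN := hlip.comp_absolutelyContinuousOnInterval hA
  have hN3 := ((hN.fun_mul hN).fun_mul hN).const_mul (1 / 3)
  -- The weight removes the boundary term at `T`, while `hle` removes the one at `a`; its derivative
  -- `-1` leaves the integral of `N³/3`.
  have hw : AbsolutelyContinuousOnInterval (fun t : ℝ => T - t) a T :=
    (contDiffOn_const.sub contDiffOn_id).absolutelyContinuousOnInterval
  have h := hN3.integral_mul_deriv_eq_deriv_mul hw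
  have hdw : ∀ t : ℝ, deriv (fun t : ℝ => T - t) t = -1 := fun t => by
    simp
  have hNa : max (c + (∫ z in y₀..a, g z) - 1 / a) 0 = 0 := max_eq_right (by linarith)
  simp only [hdw, hNa] at h
  have h2 : ∫ t in a..T, (max (c + (∫ z in y₀..t, g z) - 1 / t) 0) ^ 3 / 3
      = -∫ t in a..T, (1 / 3 * (max (c + (∫ z in y₀..t, g z) - 1 / t) 0
        * max (c + (∫ z in y₀..t, g z) - 1 / t) 0
        * max (c + (∫ z in y₀..t, g z) - 1 / t) 0)) * (-1) := by
    rw [← intervalIntegral.integral_neg]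
    congr 1; ext t; ring
  rw [h2, h]
  simp only [sub_self, mul_zero, zero_mul, zero_sub, neg_neg]
  apply intervalIntegral.integral_congr_ae
  filter_upwards [ae_hasDerivAt_primitive hg c y₀] with t ht hmem
  have ht0 : 0 < t := hpos t (uIoc_subset_uIcc hmem)
  have hd1 : HasDerivAt (fun t : ℝ => 1 / t) (-(1 / t) ^ 2) t := by
    have := hasDerivAt_inv ht0.ne'
    simp only [one_div]
    exact this.congr_deriv (by rw [inv_pow])
  have hd := ((hasDerivAt_posPart_pow 1 _).comp t (ht.sub hd1)).const_mul (1 / 3 : ℝ)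
  have hd' : HasDerivAt (fun t => 1 / 3 * (max (c + (∫ z in y₀..t, g z) - 1 / t) 0
        * max (c + (∫ z in y₀..t, g z) - 1 / t) 0
        * max (c + (∫ z in y₀..t, g z) - 1 / t) 0))
      ((max (c + (∫ z in y₀..t, g z) - 1 / t) 0) ^ 2 * (g t + (1 / t) ^ 2)) t := by
    refine (hd.congr_of_eventuallyEq (Eventually.of_forall fun s => ?_)).congr_deriv ?_
    · simp only [Function.comp, Pi.sub_apply]; ring
    · simp only [Pi.sub_apply]; push_cast; ring
  rw [hd'.deriv]

/-- By Fubini, the identity along lines in time and the inequality along lines in space concern the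
same double integral. The integral of `N³/3` is therefore nonpositive, which forces `N = 0`. -/
theorem ae_le_one_div {v r : ℝ → ℝ → ℝ} {T K a : ℝ} (ha : 0 < a) (haT : a < T) (hK : 0 ≤ K)
    (hKa : K ≤ 1 / a)
    (hv : MemLp (Function.uncurry v) 2 (volume.restrict (strip T)))
    (hr : MemLp (Function.uncurry r) 2 (volume.restrict (strip T)))
    (hbound : ∀ᵐ p ∂(volume.restrict (strip T)), |Function.uncurry v p| ≤ K)
    (htime : ∀ᵐ x : ℝ, IsPrimitiveOn (Ioi 0) 1 (fun t => extZero v (t, x))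
      (fun t => extZero r (t, x)))
    (hslice : ∀ᵐ t ∂(volume.restrict (Ioo 0 T)),
      ∫ x, (max (v t x - 1 / t) 0) ^ 2 * (r t x + (1 / t) ^ 2) ≤ 0) :
    ∀ᵐ p ∂(volume.restrict (Ioo a T ×ˢ (univ : Set ℝ))), Function.uncurry v p ≤ 1 / p.1 := by
  have hT : 0 < T := ha.trans haT
  have hsub : Ioo a T ⊆ Ioo 0 T := Ioo_subset_Ioo_left ha.le
  have hvol : (volume.restrict (Ioo a T ×ˢ univ) : Measure (ℝ × ℝ))
      = (volume.restrict (Ioo a T)).prod volume := by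
    rw [Measure.volume_eq_prod, ← Measure.prod_restrict, Measure.restrict_univ]
  have hvolT : (volume.restrict (strip T) : Measure (ℝ × ℝ))
      = (volume.restrict (Ioo 0 T)).prod volume := by
    rw [strip, Measure.volume_eq_prod, ← Measure.prod_restrict, Measure.restrict_univ]
  have hle : (volume.restrict (Ioo a T ×ˢ univ) : Measure (ℝ × ℝ)) ≤ volume.restrict (strip T) :=
    Measure.restrict_mono (prod_mono hsub le_rfl) le_rfl
  set μ : Measure (ℝ × ℝ) := (volume.restrict (Ioo a T)).prod volume with hμ
  rw [hvol] at hle ⊢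
  have hvμ : MemLp (Function.uncurry v) 2 μ := hv.mono_measure hle
  have hrμ : MemLp (Function.uncurry r) 2 μ := hr.mono_measure hle
  have hbμ : ∀ᵐ p ∂μ, |Function.uncurry v p| ≤ K := ae_mono hle hbound
  have htμ : ∀ᵐ p ∂μ, p.1 ∈ Ioo a T := by
    rw [← hvol]
    exact (ae_restrict_mem (measurableSet_Ioo.prod MeasurableSet.univ)).mono fun p hp => hp.1
  set N : ℝ × ℝ → ℝ := fun p => max (Function.uncurry v p - 1 / p.1) 0 with hN
  have hinvm : AEStronglyMeasurable (fun p : ℝ × ℝ => 1 / p.1) μ :=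
    (measurable_const.div measurable_fst).aestronglyMeasurable
  have hNm : AEStronglyMeasurable N μ :=
    (hvμ.1.sub hinvm).sup aestronglyMeasurable_const
  have hNb : ∀ᵐ p ∂μ, 0 ≤ N p ∧ N p ≤ |Function.uncurry v p| ∧ N p ≤ K := by
    filter_upwards [hbμ, htμ] with p hp ht
    have hp1 : 0 < 1 / p.1 := by have := ha.trans ht.1; positivity
    have h1 : N p ≤ |Function.uncurry v p| :=
      max_le (by linarith [le_abs_self (Function.uncurry v p)]) (abs_nonneg _)
    exact ⟨le_max_right _ _, h1, h1.trans hp⟩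
  have hv2 : Integrable (fun p => Function.uncurry v p ^ 2) μ := hvμ.integrable_sq
  have hvr : Integrable (fun p => Function.uncurry v p * Function.uncurry r p) μ :=
    hvμ.integrable_mul hrμ
  have i1 : Integrable (fun p => N p ^ 3 / 3) μ := by
    refine (hv2.const_mul K).mono' ((hNm.pow 3).mul_const (1 / 3) |>.congr
      (Eventually.of_forall fun p => by simp [div_eq_mul_inv])) ?_
    filter_upwards [hNb] with p ⟨h0, h1, h2⟩
    rw [Real.norm_of_nonneg (by positivity)]
    have : N p ^ 2 ≤ Function.uncurry v p ^ 2 := by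
      rw [← sq_abs (Function.uncurry v p)]; gcongr
    have h3 : N p ^ 3 ≤ K * Function.uncurry v p ^ 2 := by
      calc N p ^ 3 = N p * N p ^ 2 := by ring
        _ ≤ K * Function.uncurry v p ^ 2 := by gcongr
    have h4 : 0 ≤ N p ^ 3 := by positivity
    linarith
  have i2 : Integrable (fun p => N p ^ 2 * (Function.uncurry r p + (1 / p.1) ^ 2) * (T - p.1)) μ := by
    refine (((hvr.abs.const_mul K).add (hv2.const_mul ((1 / a) ^ 2))).mul_const T).mono'
      (((hNm.pow 2).mul (hrμ.1.add (hinvm.pow 2))).mul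
        (measurable_const.sub measurable_fst).aestronglyMeasurable) ?_
    filter_upwards [hNb, htμ] with p ⟨h0, h1, h2⟩ ht
    have hp1 : 0 < p.1 := ha.trans ht.1
    rw [Real.norm_eq_abs, abs_mul, abs_mul, abs_of_nonneg (by positivity : 0 ≤ N p ^ 2),
      abs_of_nonneg (by linarith [ht.2] : 0 ≤ T - p.1)]
    have hTp : 0 ≤ T - p.1 := by linarith [ht.2]
    have hTp' : T - p.1 ≤ T := by linarith
    have e1 : |Function.uncurry r p + (1 / p.1) ^ 2| ≤ |Function.uncurry r p| + (1 / a) ^ 2 := by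
      refine (abs_add_le _ _).trans ?_
      rw [abs_of_nonneg (by positivity : 0 ≤ (1 / p.1) ^ 2)]
      have := ht.1.le
      gcongr
    have e2 : N p ^ 2 ≤ Function.uncurry v p ^ 2 := by
      rw [← sq_abs (Function.uncurry v p)]; gcongr
    have e3 : N p ^ 2 ≤ K * |Function.uncurry v p| := by
      rw [sq]; gcongr
    simp only [Pi.add_apply]
    calc N p ^ 2 * |Function.uncurry r p + (1 / p.1) ^ 2| * (T - p.1)
        ≤ N p ^ 2 * (|Function.uncurry r p| + (1 / a) ^ 2) * T := by
          gcongr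
      _ = (N p ^ 2 * |Function.uncurry r p| + (1 / a) ^ 2 * N p ^ 2) * T := by ring
      _ ≤ (K * |Function.uncurry v p| * |Function.uncurry r p|
          + (1 / a) ^ 2 * Function.uncurry v p ^ 2) * T := by gcongr
      _ = _ := by rw [abs_mul]; ring
  have hxb : ∀ᵐ x : ℝ, ∀ᵐ t ∂(volume.restrict (Ioo 0 T)), |v t x| ≤ K := by
    rw [hvolT] at hbound
    have := Measure.ae_ae_of_ae_prod (μ := (volume : Measure ℝ)) (ν := volume.restrict (Ioo 0 T))
      (p := fun q => |Function.uncurry v q.swap| ≤ K) (by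
        exact (Measure.measurePreserving_swap (μ := (volume : Measure ℝ))
          (ν := volume.restrict (Ioo 0 T))).quasiMeasurePreserving.ae hbound)
    exact this
  have hx : ∀ᵐ x : ℝ, ∫ t in Ioo a T, N (t, x) ^ 3 / 3
      = ∫ t in Ioo a T, N (t, x) ^ 2 * (Function.uncurry r (t, x) + (1 / t) ^ 2) * (T - t) := by
    filter_upwards [hxb, htime] with x hxK ⟨hg, c, hc⟩
    have hVc := continuous_const_add_primitive hg c 1
    -- The bound by `K` holds only for almost every time; continuity of the representative carries
    -- it to the time `a`.
    have hVa : c + ∫ z in (1 : ℝ)..a, extZero r (z, x) ≤ 1 / a := by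
      refine (forall_le_of_ae_of_continuousOn (μ := volume) isOpen_Ioo hVc.continuousOn
        (continuousOn_const (c := K)) ?_ a ⟨ha, haT⟩).trans hKa
      filter_upwards [(ae_restrict_iff' measurableSet_Ioo).mp hxK, hc] with t h1 h2 ht
      rw [← h2 ht.1, extZero_of_pos _ ht.1]
      exact (le_abs_self _).trans (h1 ht)
    have h := integral_posPart_cube_eq hg c 1 ha haT hVa
    rw [intervalIntegral.integral_of_le haT.le, intervalIntegral.integral_of_le haT.le,
      integral_Ioc_eq_integral_Ioo, integral_Ioc_eq_integral_Ioo] at h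
    refine Eq.trans ?_ (h.trans ?_)
    · refine setIntegral_congr_ae measurableSet_Ioo ?_
      filter_upwards [hc] with t h2 ht
      have ht0 : 0 < t := ha.trans ht.1
      rw [← h2 ht0, extZero_of_pos _ ht0]
      rfl
    · refine setIntegral_congr_ae measurableSet_Ioo ?_
      filter_upwards [hc] with t h2 ht
      have ht0 : 0 < t := ha.trans ht.1
      rw [← h2 ht0, extZero_of_pos _ ht0, extZero_of_pos _ ht0]
      rfl
  have hI : ∫ p, N p ^ 3 / 3 ∂μ
      = ∫ p, N p ^ 2 * (Function.uncurry r p + (1 / p.1) ^ 2) * (T - p.1) ∂μ := by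
    rw [hμ, integral_prod_symm _ i1, integral_prod_symm _ i2]
    exact integral_congr_ae hx
  have hI2 : ∫ p, N p ^ 2 * (Function.uncurry r p + (1 / p.1) ^ 2) * (T - p.1) ∂μ ≤ 0 := by
    rw [hμ, integral_prod _ i2]
    refine integral_nonpos_of_ae ?_
    filter_upwards [ae_mono (Measure.restrict_mono hsub le_rfl) hslice,
      ae_restrict_mem measurableSet_Ioo] with t h1 ht
    simp only [Pi.zero_apply]
    rw [integral_mul_const]
    exact mul_nonpos_of_nonpos_of_nonneg h1 (by linarith [ht.2])
  have h0 : 0 ≤ᵐ[μ] fun p => N p ^ 3 / 3 := by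
    filter_upwards [hNb] with p hp
    have := hp.1
    simp only [Pi.zero_apply]
    positivity
  have hz := (integral_eq_zero_iff_of_nonneg_ae h0 i1).mp
    (le_antisymm (hI.trans_le hI2) (integral_nonneg_of_ae h0))
  filter_upwards [hz] with p hp
  simp only [Pi.zero_apply, div_eq_zero_iff, OfNat.ofNat_ne_zero, or_false, pow_eq_zero_iff,
    ne_eq, not_false_eq_true] at hp
  have := le_max_left (Function.uncurry v p - 1 / p.1) 0
  simp only [hN] at hp
  linarith

/-- Passing from slices to the product needs a measurable set, hence the detour through a measurable
representative. -/
theorem ae_prod_le_of_ae_ae_le {α β : Type*} [MeasurableSpace α] [MeasurableSpace β]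
    {μ : Measure α} {ν : Measure β} [SFinite ν] {f : α × β → ℝ}
    (hf : AEStronglyMeasurable f (μ.prod ν)) {K : ℝ}
    (h : ∀ᵐ t ∂μ, ∀ᵐ x ∂ν, f (t, x) ≤ K) : ∀ᵐ p ∂(μ.prod ν), f p ≤ K := by
  have h1 := hf.ae_eq_mk
  have h2 : ∀ᵐ p ∂(μ.prod ν), hf.mk f p ≤ K := by
    have hm : MeasurableSet {p | hf.mk f p ≤ K} :=
      measurableSet_le hf.stronglyMeasurable_mk.measurable measurable_const
    rw [Measure.ae_prod_iff_ae_ae hm]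
    filter_upwards [h, Measure.ae_ae_of_ae_prod h1] with t ht ht2
    filter_upwards [ht, ht2] with x hx hx2
    rwa [← hx2]
  filter_upwards [h1, h2] with p hp hp2
  rwa [hp]

theorem integral_sq_le_of_eLpNorm_le {f : ℝ → ℝ} (hf : MemLp f 2 volume) {M : ℝ≥0}
    (h : eLpNorm f 2 volume ≤ M) : ∫ x, f x ^ 2 ≤ (M : ℝ) ^ 2 := by
  rw [hf.eLpNorm_eq_integral_rpow_norm (by norm_num) (by norm_num)] at h
  have h1 := ENNReal.toReal_mono (by simp) h
  rw [ENNReal.toReal_ofReal (by positivity)] at h1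
  simp only [ENNReal.toReal_ofNat, ENNReal.coe_toReal, Real.rpow_ofNat, Real.norm_eq_abs,
    sq_abs] at h1
  have h0 : 0 ≤ ∫ x, f x ^ 2 := integral_nonneg fun x => sq_nonneg _
  calc ∫ x, f x ^ 2 = ((∫ x, f x ^ 2) ^ (2⁻¹ : ℝ)) ^ 2 := by
        rw [← Real.rpow_natCast, ← Real.rpow_mul h0]; norm_num
    _ ≤ (M : ℝ) ^ 2 := by gcongr

theorem MemLinftyL2.exists_bound {T : ℝ} {f : ℝ → ℝ → ℝ} (h : MemLinftyL2 T f) :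
    ∃ M : ℝ, ∀ᵐ t ∂(volume.restrict (Ioo 0 T)), MemLp (f t) 2 volume ∧ ∫ x, f t x ^ 2 ≤ M := by
  obtain ⟨hm, M, hM⟩ := h
  refine ⟨(M : ℝ) ^ 2, ?_⟩
  have hvol : (volume.restrict (strip T) : Measure (ℝ × ℝ))
      = (volume.restrict (Ioo 0 T)).prod volume := by
    rw [strip, Measure.volume_eq_prod, ← Measure.prod_restrict, Measure.restrict_univ]
  rw [hvol] at hm
  filter_upwards [hm.prodMk_left, hM] with t h1 h2
  have h3 : MemLp (f t) 2 volume := ⟨h1, h2.trans_lt (by simp)⟩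
  exact ⟨h3, integral_sq_le_of_eLpNorm_le h3 h2⟩

/-- Oleinik's condition for the regularized problem. -/
theorem IsViscoplasticSolution.sub_le_div {ε : ℝ} (hε : 0 < ε) {uin : ℝ → ℝ} {u : ℝ → ℝ → ℝ}
    (h : IsViscoplasticSolution ε uin u) {t : ℝ} (ht : 0 < t) {x y : ℝ} (hxy : x ≤ y) :
    u t y - u t x ≤ (y - x) / t := by
  obtain ⟨v, w, q, r, hv, hw, hq, hr, hT, heq⟩ := h.weak
  have huL := fun T hT0 => (hT T hT0).1.memLp
  have hvL := fun T hT0 => (hT T hT0).2.1.memLp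
  have hwL := fun T hT0 => (hT T hT0).2.2.1.memLp
  have hqL := fun T hT0 => (hT T hT0).2.2.2.1.memLp
  have hrL : ∀ T : ℝ, 0 < T → MemLp (Function.uncurry r) 2 (volume.restrict (strip T)) :=
    fun T hT0 => (hT T hT0).2.2.2.2.2
  have hul := locallyIntegrable_extZero_of_memLp huL
  have hvl := locallyIntegrable_extZero_of_memLp hvL
  have hwl := locallyIntegrable_extZero_of_memLp hwL
  have hql := locallyIntegrable_extZero_of_memLp hqL
  have hrl := locallyIntegrable_extZero_of_memLp hrL
  have s1 := hv.ae_isPrimitiveOn_snd hul hvl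
  have s2 := hw.ae_isPrimitiveOn_snd hvl hwl
  have s3 := (isWeakPartial_flux hε huL hvL hq heq).ae_isPrimitiveOn_snd
    (locallyIntegrable_extZero_flux hε huL hvL) hql
  have s4 := hr.ae_isPrimitiveOn_snd hql hrl
  have htime := (hv.comm hq hr).ae_isPrimitiveOn_fst hvl hrl
  set T := t + 1 with hTdef
  have hT0 : 0 < T := by positivity
  obtain ⟨M₁, hM₁⟩ := (hT T hT0).2.1.exists_bound
  obtain ⟨M₂, hM₂⟩ := (hT T hT0).2.2.1.exists_bound
  have hcont : ∀ s, 0 < s → Continuous (u s) := fun s hs =>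
    (h.continuousOn.comp_continuous (f := fun x : ℝ => (s, x)) (by fun_prop)
      fun x => ⟨hs.le, mem_univ _⟩)
  have hest : ∀ᵐ s ∂(volume.restrict (Ioo 0 T)),
      (∀ᵐ x, |v s x| ≤ √(M₁ + M₂)) ∧
        ∫ x, (max (v s x - 1 / s) 0) ^ 2 * (r s x + (1 / s) ^ 2) ≤ 0 := by
    filter_upwards [ae_restrict_of_ae s1, ae_restrict_of_ae s2, ae_restrict_of_ae s3,
      ae_restrict_of_ae s4, hM₁, hM₂, ae_restrict_mem measurableSet_Ioo]
      with s a1 a2 a3 a4 ⟨b1, b1'⟩ ⟨b2, b2'⟩ hs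
    obtain ⟨e1, e2⟩ := slice_estimates hε (hcont s hs.1) b1 b2 (a1 hs.1) (a2 hs.1) (a3 hs.1)
      (a4 hs.1)
    refine ⟨e1.mono fun x hx => ?_, e2 _ (one_div_pos.mpr hs.1)⟩
    exact Real.abs_le_sqrt (by linarith)
  set K := √(M₁ + M₂) with hKdef
  have hK : 0 ≤ K := Real.sqrt_nonneg _
  -- The first entry puts `a` before `t`; the second ensures `K ≤ 1/a`, so the barrier dominates at
  -- the starting time.
  set a := min (t / 2) (1 / (K + 1)) with hadef
  have ha : 0 < a := lt_min (by positivity) (by positivity)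
  have hat : a < t := (min_le_left _ _).trans_lt (by linarith)
  have haT : a < T := by linarith
  have hKa : K ≤ 1 / a := by
    rw [le_div_iff₀ ha]
    calc K * a ≤ K * (1 / (K + 1)) := by gcongr; exact min_le_right _ _
      _ ≤ 1 := by rw [mul_one_div, div_le_one (by positivity)]; linarith
  have hvolT : (volume.restrict (strip T) : Measure (ℝ × ℝ))
      = (volume.restrict (Ioo 0 T)).prod volume := by
    rw [strip, Measure.volume_eq_prod, ← Measure.prod_restrict, Measure.restrict_univ]
  have hbound : ∀ᵐ p ∂(volume.restrict (strip T)), |Function.uncurry v p| ≤ K := by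
    have hm := (hvL T hT0).1.norm
    rw [hvolT] at hm ⊢
    exact ae_prod_le_of_ae_ae_le hm (hest.mono fun s hs => hs.1)
  have hle := ae_le_one_div ha haT hK hKa (hvL T hT0) (hrL T hT0) hbound htime
    (hest.mono fun s hs => hs.2)
  rw [Measure.volume_eq_prod, ← Measure.prod_restrict, Measure.restrict_univ] at hle
  have hle2 := (ae_restrict_iff' measurableSet_Ioo).mp (Measure.ae_ae_of_ae_prod hle)
  -- The estimate is obtained at almost every time and reaches `t` by continuity of `u` in time, for
  -- fixed `x` and `y`.
  refine forall_le_of_ae_of_continuousOn (μ := volume) (U := Ioo a T) isOpen_Ioo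
    (f := fun s => u s y - u s x) (g := fun s => (y - x) / s) ?_ ?_ ?_ t ⟨hat, by linarith⟩
  · have : ∀ z, ContinuousOn (fun s => u s z) (Ioo a T) := fun z =>
      h.continuousOn.comp (f := fun s : ℝ => (s, z)) (by fun_prop)
        fun s hs => ⟨(ha.trans hs.1).le, mem_univ _⟩
    exact (this y).sub (this x)
  · exact continuousOn_const.div continuousOn_id fun s hs => (ha.trans hs.1).ne'
  · filter_upwards [hle2, s1] with s h1 h2 hs
    have hs0 : 0 < s := ha.trans hs.1
    obtain ⟨hloc, c, hc⟩ := h2 hs0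
    have hcu : u s = fun x => c + ∫ z in (0 : ℝ)..x, v s z := by
      rw [← Continuous.ae_eq_iff_eq volume (hcont s hs0) (continuous_const_add_primitive hloc c 0)]
      filter_upwards [hc] with z hz using hz (mem_univ _)
    rw [hcu]
    have hsub : (∫ z in (0 : ℝ)..y, v s z) - ∫ z in (0 : ℝ)..x, v s z = ∫ z in x..y, v s z :=
      intervalIntegral.integral_interval_sub_left (hloc.intervalIntegrable_uIoc _ _)
        (hloc.intervalIntegrable_uIoc _ _)
    have hint : ∫ z in x..y, v s z ≤ ∫ z in x..y, 1 / s :=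
      intervalIntegral.integral_mono_ae hxy (hloc.intervalIntegrable_uIoc _ _)
        intervalIntegrable_const ((h1 hs).mono fun z hz => hz)
    rw [intervalIntegral.integral_const, smul_eq_mul, mul_one_div] at hint
    simp only
    linarith

/-! ### Passage to the limit -/

theorem ae_exists_slice_of_tendsto {v : ℕ → ℝ → ℝ → ℝ} {u : ℝ → ℝ → ℝ}
    (hv : ∀ k, ContinuousOn (Function.uncurry (v k)) (Ici 0 ×ˢ univ))
    (hle : ∀ k t x y, 0 < t → x ≤ y → v k t y - v k t x ≤ (y - x) / t)
    (hlim : TendstoL2loc v u) {T r : ℝ} (hT : 0 < T) (hr : 0 < r) :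
    ∀ᵐ t ∂(volume.restrict (Ioo 0 T)), ∃ G : Set ℝ, (∀ᵐ x, x ∈ Ioo (-r) r → x ∈ G) ∧
      ∀ x ∈ G, ∀ y ∈ G, x ≤ y → u t y - u t x ≤ (y - x) / t := by
  have hvol : (volume.restrict (Ioo 0 T ×ˢ Ioo (-r) r) : Measure (ℝ × ℝ))
      = (volume.restrict (Ioo 0 T)).prod (volume.restrict (Ioo (-r) r)) := by
    rw [Measure.volume_eq_prod, ← Measure.prod_restrict]
  have hsub : Ioo 0 T ×ˢ Ioo (-r) r ⊆ Ioi (0 : ℝ) ×ˢ (univ : Set ℝ) :=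
    prod_mono (fun t ht => ht.1) (subset_univ _)
  have hm1 : ∀ k, AEStronglyMeasurable (Function.uncurry (v k))
      (volume.restrict (Ioo 0 T ×ˢ Ioo (-r) r)) := fun k =>
    ((hv k).mono (hsub.trans (prod_mono Ioi_subset_Ici_self le_rfl))).aestronglyMeasurable
      (measurableSet_Ioo.prod measurableSet_Ioo)
  have hm2 : AEStronglyMeasurable (Function.uncurry u)
      (volume.restrict (Ioo 0 T ×ˢ Ioo (-r) r)) :=
    hlim.1.mono_measure (Measure.restrict_mono hsub le_rfl)
  obtain ⟨ns, -, hns⟩ := (tendstoInMeasure_of_tendsto_eLpNorm (by norm_num) hm1 hm2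
    (hlim.2 T r hT hr)).exists_seq_tendsto_ae
  rw [hvol] at hns
  filter_upwards [Measure.ae_ae_of_ae_prod hns, ae_restrict_mem measurableSet_Ioo] with t ht ht0
  refine ⟨{x | Tendsto (fun i => v (ns i) t x) atTop (𝓝 (u t x))}, ?_, ?_⟩
  · exact (ae_restrict_iff' measurableSet_Ioo).mp ht
  · intro x hx y hy hxy
    exact le_of_tendsto' (hy.sub hx) fun i => hle _ t x y ht0.1 hxy

/-- A one-sided Lipschitz estimate passes to `L²`-limits, at almost every time. -/
theorem ae_exists_conull_slice {v : ℕ → ℝ → ℝ → ℝ} {u : ℝ → ℝ → ℝ}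
    (hv : ∀ k, ContinuousOn (Function.uncurry (v k)) (Ici 0 ×ˢ univ))
    (hle : ∀ k t x y, 0 < t → x ≤ y → v k t y - v k t x ≤ (y - x) / t)
    (hlim : TendstoL2loc v u) {T : ℝ} (hT : 0 < T) :
    ∀ᵐ t ∂(volume.restrict (Ioo 0 T)), ∃ G : Set ℝ, (∀ᵐ x, x ∈ G) ∧
      ∀ x ∈ G, ∀ y ∈ G, x ≤ y → u t y - u t x ≤ (y - x) / t := by
  have h := ae_all_iff.mpr fun n : ℕ =>
    ae_exists_slice_of_tendsto hv hle hlim hT (show (0 : ℝ) < n + 1 by positivity)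
  filter_upwards [h] with t ht
  choose G hG hG2 using ht
  -- The subsequence may differ with `n`; this is harmless because any two points lie in one common
  -- window and the estimate involves only the limit.
  refine ⟨{x | ∀ n : ℕ, x ∈ Ioo (-((n : ℝ) + 1)) (n + 1) → x ∈ G n}, ae_all_iff.mpr hG, ?_⟩
  intro x hx y hy hxy
  obtain ⟨n, hn⟩ := exists_nat_ge (max |x| |y|)
  have h1 : |x| < n + 1 := by linarith [le_max_left |x| |y|]
  have h2 : |y| < n + 1 := by linarith [le_max_right |x| |y|]
  exact hG2 n x (hx n (abs_lt.mp h1)) y (hy n (abs_lt.mp h2)) hxy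

/-- Choose good times decreasing to `t`. Continuity in `L¹` gives almost everywhere convergence
along a subsequence, and `1/s` tends to `1/t`. -/
theorem exists_conull_slice {v : ℕ → ℝ → ℝ → ℝ} {u : ℝ → ℝ → ℝ}
    (hv : ∀ k, ContinuousOn (Function.uncurry (v k)) (Ici 0 ×ˢ univ))
    (hle : ∀ k t x y, 0 < t → x ≤ y → v k t y - v k t x ≤ (y - x) / t)
    (hlim : TendstoL2loc v u) (hu : MemCL1 u) {t : ℝ} (ht : 0 < t) :
    ∃ G : Set ℝ, (∀ᵐ x, x ∈ G) ∧
      ∀ x ∈ G, ∀ y ∈ G, x ≤ y → u t y - u t x ≤ (y - x) / t := by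
  have hae := ae_exists_conull_slice hv hle hlim (show 0 < t + 1 by positivity)
  have hex : ∀ n : ℕ, ∃ s, (t < s ∧ s < t + 1 / ((n : ℝ) + 1)) ∧ ∃ G : Set ℝ, (∀ᵐ x, x ∈ G) ∧
      ∀ x ∈ G, ∀ y ∈ G, x ≤ y → u s y - u s x ≤ (y - x) / s := by
    intro n
    have hn : 0 < 1 / ((n : ℝ) + 1) := by positivity
    have hn1 : 1 / ((n : ℝ) + 1) ≤ 1 := by
      rw [div_le_one (by positivity)]; linarith [(Nat.cast_nonneg n : (0 : ℝ) ≤ n)]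
    have hsub : Ioo t (t + 1 / ((n : ℝ) + 1)) ⊆ Ioo 0 (t + 1) :=
      Ioo_subset_Ioo ht.le (by linarith)
    have h1 := ae_mono (Measure.restrict_mono hsub le_rfl) hae
    have : NeBot (ae (volume.restrict (Ioo t (t + 1 / ((n : ℝ) + 1))))) := by
      rw [ae_neBot, ne_eq, Measure.restrict_eq_zero, Real.volume_Ioo]
      simpa using hn
    obtain ⟨s, hs1, hs2⟩ := (Filter.Eventually.and h1 (ae_restrict_mem measurableSet_Ioo)).exists
    exact ⟨s, hs2, hs1⟩
  choose s hs G hG hG2 using hex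
  have hst : Tendsto s atTop (𝓝 t) := by
    refine tendsto_of_tendsto_of_tendsto_of_le_of_le tendsto_const_nhds
      (?_ : Tendsto (fun n : ℕ => t + 1 / ((n : ℝ) + 1)) atTop (𝓝 t))
      (fun n => (hs n).1.le) (fun n => (hs n).2.le)
    simpa using tendsto_const_nhds.add tendsto_one_div_add_atTop_nhds_zero_nat (a := t)
  have hst' : Tendsto s atTop (𝓝[Ici 0] t) :=
    tendsto_nhdsWithin_iff.mpr ⟨hst, Eventually.of_forall fun n => (ht.trans (hs n).1).le⟩
  have hL := (hu.2 t ht.le).comp hst'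
  obtain ⟨ns, hmono, hns⟩ := (tendstoInMeasure_of_tendsto_eLpNorm (by norm_num)
    (fun n => (hu.1 (s n) (ht.trans (hs n).1).le).aestronglyMeasurable)
    (hu.1 t ht.le).aestronglyMeasurable hL).exists_seq_tendsto_ae
  refine ⟨{x | (∀ n, x ∈ G n) ∧ Tendsto (fun i => u (s (ns i)) x) atTop (𝓝 (u t x))},
    (ae_all_iff.mpr hG).and hns, ?_⟩
  intro x hx y hy hxy
  refine le_of_tendsto_of_tendsto' (hy.2.sub hx.2)
    (tendsto_const_nhds.div (hst.comp hmono.tendsto_atTop) ht.ne')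
    fun i => hG2 (ns i) x (hx.1 _) y (hy.1 _) hxy

/-! ### Distributional and pointwise consequences -/

/-- An almost everywhere one-sided Lipschitz estimate implies the distributional one. -/
theorem neg_integral_mul_deriv_le {f : ℝ → ℝ} (hf : Integrable f volume) {t : ℝ} {G : Set ℝ}
    (hG : ∀ᵐ x, x ∈ G) (hle : ∀ x ∈ G, ∀ y ∈ G, x ≤ y → f y - f x ≤ (y - x) / t)
    {φ : ℝ → ℝ} (hφ : ContDiff ℝ ∞ φ) (hc : HasCompactSupport φ) (h0 : ∀ x, 0 ≤ φ x) :
    -∫ x, f x * deriv φ x ≤ ∫ x, φ x / t := by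
  obtain ⟨L, hL⟩ := ContDiff.lipschitzWith_of_hasCompactSupport hc hφ (by simp)
  have hφi : Integrable φ volume := hφ.continuous.integrable_of_hasCompactSupport hc
  have hlim : Tendsto (fun h : ℝ => ∫ x, f x * (h⁻¹ * (φ (x + h) - φ x))) (𝓝[>] 0)
      (𝓝 (∫ x, f x * deriv φ x)) := by
    refine tendsto_integral_filter_of_dominated_convergence (fun x => |f x| * L)
      (Eventually.of_forall fun h => hf.aestronglyMeasurable.mul
        (by apply Continuous.aestronglyMeasurable; have := hφ.continuous; fun_prop)) ?_
      (hf.abs.mul_const _) (Eventually.of_forall fun x => ?_)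
    · filter_upwards [self_mem_nhdsWithin] with h hh
      refine Eventually.of_forall fun x => ?_
      have hh' : (0 : ℝ) < h := hh
      rw [norm_mul, Real.norm_eq_abs, norm_mul, norm_inv, Real.norm_of_nonneg hh'.le]
      have h1 := hL.dist_le_mul (x + h) x
      rw [Real.dist_eq, Real.dist_eq, add_sub_cancel_left, abs_of_pos hh'] at h1
      gcongr
      rw [Real.norm_eq_abs, inv_mul_le_iff₀ hh']
      linarith
    · have := ((hφ.differentiable (by simp)) x).hasDerivAt.tendsto_slope_zero_right
      simpa [smul_eq_mul] using this.const_mul (f x)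
  refine le_of_tendsto hlim.neg ?_
  filter_upwards [self_mem_nhdsWithin] with h hh
  have hh' : (0 : ℝ) < h := hh
  have hb : ∃ C, ∀ x, ‖φ x‖ ≤ C := hc.exists_bound_of_continuous hφ.continuous
  obtain ⟨C, hC⟩ := hb
  have hfs : Integrable (fun x => f (x - h)) volume := hf.comp_sub_right h
  have hmul : ∀ g : ℝ → ℝ, Integrable g volume → Integrable (fun x => g x * φ x) volume := fun g hg =>
    hg.mul_bdd hφ.continuous.aestronglyMeasurable (Eventually.of_forall hC)
  have i1 := hmul f hf
  have i2 := hmul _ hfs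
  have i3 : Integrable (fun x => f x * φ (x + h)) volume := by
    have := i2.comp_add_right h
    simpa using this
  have e1 : ∫ x, f x * φ (x + h) = ∫ x, f (x - h) * φ x := by
    rw [← integral_add_right_eq_self (fun x => f (x - h) * φ x) h]
    simp
  -- Discrete integration by parts: translation moves the difference quotient from `φ` to `f`, where
  -- the one-sided bound and `φ ≥ 0` apply.
  have e2 : -∫ x, f x * (h⁻¹ * (φ (x + h) - φ x)) = ∫ x, h⁻¹ * ((f x - f (x - h)) * φ x) := by
    have a1 : ∫ x, f x * (h⁻¹ * (φ (x + h) - φ x))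
        = h⁻¹ * ((∫ x, f x * φ (x + h)) - ∫ x, f x * φ x) := by
      rw [← integral_sub i3 i1, ← integral_const_mul]
      congr 1; ext x; ring
    have a2 : ∫ x, h⁻¹ * ((f x - f (x - h)) * φ x)
        = h⁻¹ * ((∫ x, f x * φ x) - ∫ x, f (x - h) * φ x) := by
      rw [← integral_sub i1 i2, ← integral_const_mul]
      congr 1; ext x; ring
    rw [a1, a2, e1]; ring
  rw [e2]
  have i4 : Integrable (fun x => h⁻¹ * ((f x - f (x - h)) * φ x)) volume :=
    ((hmul _ (hf.sub hfs)).const_mul h⁻¹)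
  refine integral_mono_ae i4 (hφi.div_const t) ?_
  have hG' : ∀ᵐ x, x - h ∈ G :=
    (measurePreserving_sub_right volume h).quasiMeasurePreserving.ae hG
  filter_upwards [hG, hG'] with x hx hx'
  have h1 := hle (x - h) hx' x hx (by linarith)
  rw [sub_sub_cancel] at h1
  calc h⁻¹ * ((f x - f (x - h)) * φ x) ≤ h⁻¹ * (h / t * φ x) := by
        have := h0 x
        gcongr
    _ = φ x / t := by field_simp

/-- For any fixed `x`, the maps `h ↦ x + h` and `h ↦ x - h` preserve null sets, so both points are
good for almost every `h`. Strictness comes from `4Ch > 0`. -/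
theorem ae_ae_sub_lt {f : ℝ → ℝ} {t C : ℝ} (hC : 0 < C) {G : Set ℝ}
    (hG : ∀ᵐ x, x ∈ G) (hle : ∀ x ∈ G, ∀ y ∈ G, x ≤ y → f y - f x ≤ (y - x) / t) (x : ℝ) :
    ∀ᵐ h ∂(volume.restrict (Ioi (0 : ℝ))), f (x + h) - f (x - h) < 2 * h / t + 4 * C * h := by
  have h1 : ∀ᵐ h : ℝ, x + h ∈ G :=
    (measurePreserving_add_left volume x).quasiMeasurePreserving.ae hG
  have h2 : ∀ᵐ h : ℝ, x - h ∈ G :=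
    (Measure.measurePreserving_sub_left volume x).quasiMeasurePreserving.ae hG
  filter_upwards [ae_restrict_of_ae h1, ae_restrict_of_ae h2, ae_restrict_mem measurableSet_Ioi]
    with h a1 a2 hh
  have hh' : (0 : ℝ) < h := hh
  have h3 := hle _ a2 _ a1 (by linarith)
  rw [show x + h - (x - h) = 2 * h by ring] at h3
  have : 0 < 4 * C * h := by positivity
  linarith

end PlasticBurgers

theorem proposition2p6
    -- viscosities tending to zero, initial data and solutions of the regularized problems
    (ε : ℕ → ℝ) (hε : ∀ k, 0 < ε k) (hε0 : Tendsto ε atTop (𝓝 0))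
    (uin : ℕ → ℝ → ℝ) (huin : ∀ k, PlasticBurgers.MemH2 (uin k))
    (C : ℝ) (hC : 0 < C)
    (hBV : ∀ k, eLpNorm (deriv (uin k)) 1 volume ≤ ENNReal.ofReal C)
    (uε : ℕ → ℝ → ℝ → ℝ)
    (huε : ∀ k, PlasticBurgers.IsViscoplasticSolution (ε k) (uin k) (uε k))
    -- the limit
    (u : ℝ → ℝ → ℝ) (hu : PlasticBurgers.MemCL1 u) (hlim : PlasticBurgers.TendstoL2loc uε u) :
    (∀ t : ℝ, 0 < t → ∀ φ : ℝ → ℝ, ContDiff ℝ ∞ φ → HasCompactSupport φ → (∀ x, 0 ≤ φ x) →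
      -∫ x, u t x * deriv φ x ≤ ∫ x, φ x / t) ∧
    (∀ t : ℝ, 0 < t → ∀ᵐ x : ℝ, ∀ᵐ h ∂(volume.restrict (Ioi (0 : ℝ))),
      u t (x + h) - u t (x - h) < 2 * h / t + 4 * C * h) := by
  have hcont := fun k => (huε k).continuousOn
  have hle : ∀ k t x y, 0 < t → x ≤ y → uε k t y - uε k t x ≤ (y - x) / t :=
    fun k t x y ht hxy => (huε k).sub_le_div (hε k) ht hxy
  refine ⟨fun t ht φ hφ hc h0 => ?_, fun t ht => ?_⟩
  · obtain ⟨G, hG, hG2⟩ := PlasticBurgers.exists_conull_slice hcont hle hlim hu ht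
    exact PlasticBurgers.neg_integral_mul_deriv_le (hu.1 t ht.le) hG hG2 hφ hc h0
  · obtain ⟨G, hG, hG2⟩ := PlasticBurgers.exists_conull_slice hcont hle hlim hu ht
    exact Eventually.of_forall fun x => PlasticBurgers.ae_ae_sub_lt hC hG hG2 x
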